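/- All graphs are finite and simple. A set $S$ of vertices of a graph $G$ is $k$-sparse if every vertex of $S$ has at most $k$ neighbours in $S$, and $k$-dense if it is $k$-sparse in the complement of $G$; an $i$-set is a set of $i$ vertices. A graph is perfect if the chromatic number of each of its induced subgraphs equals the clique number of that subgraph. Let $R_1^{\mathcal{PG}}(4,9)$ be the smallest $n$ such that every perfect graph on $n$ vertices has a $1$-dense $4$-set or a $1$-sparse $9$-set. An extremal graph for $R_1^{\mathcal{PG}}(4,9)=n$ is a perfect graph on $n-1$ vertices that has neither a $1$-dense $4$-set nor a $1$-sparse $9$-set. Let $G_4$ be the graph with vertex set $\{0,1,\dots,17\}$ and the following $33$ edges (written $a\,b$): the edges $0\,1,\ 0\,2,\ 1\,2,\ 3\,4,\ 3\,5,\ 4\,5,\ 6\,7,\ 6\,8,\ 7\,8,\ 9\,10,\ 9\,11,\ 10\,11$ of four disjoint triangles, the edges $0\,3,\ 1\,6,\ 2\,9,\ 4\,7,\ 5\,10,\ 8\,11$ (one between any two of these triangles), the edges $12\,0,\ 12\,3,\ 13\,1,\ 13\,6,\ 14\,2,\ 14\,9,\ 15\,4,\ 15\,7,\ 16\,5,\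 16\,10,\ 17\,8,\ 17\,11$, and the edges $12\,17,\ 13\,16,\ 14\,15$. **Theorem.** $R_1^{\mathcal{PG}}(4,9)=19$, and up to isomorphism $G_4$ is the unique extremal graph for $R_1^{\mathcal{PG}}(4,9)$: $G_4$ is a perfect graph on $18$ vertices with neither a $1$-dense $4$-set nor a $1$-sparse $9$-set, and every such graph is isomorphic to $G_4$. -/

import Mathlib

namespace SimpleGraph

variable {V : Type*}

/-- A finite set `S` of vertices is `k`-sparse if every vertex of `S` has at most `k` neighbours
in `S`. -/
def IsSparseSet (G : SimpleGraph V) (k : ℕ) (S : Finset V) : Prop :=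
  ∀ v ∈ S, (G.neighborSet v ∩ (S : Set V)).ncard ≤ k

/-- A finite set of vertices is `k`-dense if it is `k`-sparse in the complement graph. -/
def IsDenseSet (G : SimpleGraph V) (k : ℕ) (S : Finset V) : Prop :=
  Gᶜ.IsSparseSet k S

/-- `G` has a `k`-dense `i`-set or a `k`-sparse `j`-set. -/
def HasDefectiveSet (G : SimpleGraph V) (k i j : ℕ) : Prop :=
  (∃ S : Finset V, S.card = i ∧ G.IsDenseSet k S) ∨
    ∃ S : Finset V, S.card = j ∧ G.IsSparseSet k S

/-- A graph is perfect if the chromatic number and the clique number of every induced subgraph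
agree. -/
def IsPerfect (G : SimpleGraph V) : Prop :=
  ∀ S : Set V, (G.induce S).chromaticNumber = (G.induce S).cliqueNum

/-- The class of (finite) perfect graphs. -/
def perfectGraphs (n : ℕ) (G : SimpleGraph (Fin n)) : Prop :=
  G.IsPerfect

/-- `r` is the defective Ramsey number `R_k(i, j)` of the graph class `𝒢`: the smallest `n` such
that every graph on `n` vertices in the class has a `k`-dense `i`-set or a `k`-sparse `j`-set. -/
def IsDefectiveRamseyNumber (𝒢 : ∀ n : ℕ, SimpleGraph (Fin n) → Prop) (k i j r : ℕ) : Prop :=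
  IsLeast {n : ℕ | ∀ G : SimpleGraph (Fin n), 𝒢 n G → G.HasDefectiveSet k i j} r

/-- `G` is extremal for the defective Ramsey number `R_k(i, j)` of the class `𝒢`: it belongs to
the class, has order `R_k(i, j) - 1`, and has neither a `k`-dense `i`-set nor a `k`-sparse
`j`-set. -/
def IsExtremalGraph (𝒢 : ∀ n : ℕ, SimpleGraph (Fin n) → Prop) (k i j : ℕ) {n : ℕ}
    (G : SimpleGraph (Fin n)) : Prop :=
  IsDefectiveRamseyNumber 𝒢 k i j (n + 1) ∧ 𝒢 n G ∧ ¬ G.HasDefectiveSet k i j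

/-- The edges of `G₄`. The vertices `0, …, 11` carry a truncated tetrahedron: four disjoint
triangles with exactly one edge between any two of them. Each of these six edges forms a triangle
with one of the vertices `12, …, 17`, and two of those six vertices are adjacent exactly when the
corresponding two edges join disjoint pairs of triangles. -/
def edgesG₄ : List (Fin 18 × Fin 18) :=
  [(0, 1), (0, 2), (1, 2), (3, 4), (3, 5), (4, 5), (6, 7), (6, 8), (7, 8), (9, 10), (9, 11),
   (10, 11),
   (0, 3), (1, 6), (2, 9), (4, 7), (5, 10), (8, 11),
   (12, 0), (12, 3), (13, 1), (13, 6), (14, 2), (14, 9), (15, 4), (15, 7), (16, 5), (16, 10),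
   (17, 8), (17, 11),
   (12, 17), (13, 16), (14, 15)]

/-- The graph `G₄` on 18 vertices with 33 edges. -/
def G₄ : SimpleGraph (Fin 18) :=
  SimpleGraph.fromRel fun a b => (a, b) ∈ edgesG₄

end SimpleGraph

/-!
A perfect graph without a `1`-dense `4`-set has no cycle of length four or five: the vertices of a
`4`-cycle form a `1`-dense set, and a `5`-cycle either has a chord, which closes a `4`-cycle, or is
an induced `5`-cycle, whose chromatic number exceeds its clique number
(`SimpleGraph.IsPerfect.noShortCycle`). A `1`-sparse set is one that induces a matching
(`InducesMatching`). The upper bound and the uniqueness of `G₄` therefore follow from a statement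
about graphs without `4`- and `5`-cycles: among `19` vertices there are `9` that induce a matching,
and if this fails for `18` vertices, then they induce a copy of `G₄`.

Let `F j n` be the set of the graphs without `4`- and `5`-cycles on `n` vertices in which no `j`
vertices induce a matching. The graphs in `F 9 18` are found by descent. If `v` is a vertex of a
member `W` of `F j n`, deleting `v` and its neighbours leaves a member of `F (j - 1) n'`, as `v` can
be added to a set inducing a matching in what is left; likewise, deleting the ends of an edge and
all their neighbours leaves a member of `F (j - 2) n'`. Hence `W` arises from a smaller graph by
gluing a star with at most two leaves to it, or by gluing an edge with its neighbours to it. The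
latter is needed only if all degrees are at least three, and then a counting argument finds an
edge such that it and its neighbours are at most five vertices if `n ≤ 12`, and at most six if
`n ≤ 18` (`lt_card_of_forall_le_card_union`): otherwise the trees of depth two that grow from the
vertices of a triangle, or from the ends of any edge if there is no triangle, already have too many
vertices, as they are disjoint in the absence of short cycles.

All gluings are iterated one-vertex extensions (`GraphCode.extensions`), which are computed up to
isomorphism by evaluation in the kernel. Starting from the graphs on at most seven vertices in
`F 4` and `F 5`, this gives in turn the four members of `F 6 9`, the three members of `F 7 12`, that
`F 8 15` is empty, that `G₄` is the only member of `F 9 18`, and that `F 9 19` is empty. The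
computation is arranged so that every search is either proved exhaustive or has its result checked:
dropping a graph requires an explicit set inducing a matching, and identifying two graphs an
explicit isomorphism.

For the lower bound, `G₄` is perfect because it is `3`-colourable and its triangle-free induced
subgraphs are bipartite (`SimpleGraph.isPerfect_of_colorings`), which is again a finite search. As
the argument applies to the induced subgraphs of `G₄` too, no `n ≤ 18` has the Ramsey property.
-/

namespace GraphCode

/-! ### Bitwise arithmetic that the kernel evaluates quickly -/

/-- `force x k` is `k x`, but evaluating it first brings `x` to a numeral. -/
noncomputable def force {α : Type} (x : ℕ) (k : ℕ → α) : α :=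
  Nat.rec (k 0) (fun n _ => k (Nat.succ n)) x

@[simp]
theorem force_eq {α : Type} (x : ℕ) (k : ℕ → α) : force x k = k x := by
  cases x <;> rfl

/-- Row `i` of the bit matrix `A`, whose entry `(i, j)` is bit `32 * i + j` of the number `A`. -/
def row (A i : ℕ) : ℕ := Nat.land (Nat.shiftRight A (Nat.mul 32 i)) 4294967295

theorem testBit_row (A i j : ℕ) :
    (row A i).testBit j = (decide (j < 32) && A.testBit (32 * i + j)) := by
  change ((A >>> (32 * i)) &&& (2 ^ 32 - 1)).testBit j = _
  rw [Nat.testBit_and, Nat.testBit_shiftRight, Nat.testBit_two_pow_sub_one, Bool.and_comm]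

theorem row_lt (A i : ℕ) : row A i < 2 ^ 32 :=
  Nat.lt_pow_two_of_testBit _ fun j hj => by
    rw [testBit_row, decide_eq_false (by omega), Bool.false_and]

/-- Bit `i` of `m`. -/
def hasBit (m i : ℕ) : Bool := Nat.beq (Nat.land (Nat.shiftRight m i) 1) 1

@[simp]
theorem hasBit_eq (m i : ℕ) : hasBit m i = m.testBit i := by
  change Nat.beq ((m >>> i) &&& 1) 1 = _
  rw [Nat.testBit, Nat.and_comm 1, Nat.and_one_is_mod]
  rcases Nat.mod_two_eq_zero_or_one (m >>> i) with h | h <;> rw [h] <;> rfl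

theorem shiftLeft_eq (m i : ℕ) : Nat.shiftLeft m i = m <<< i := rfl

theorem testBit_one_shiftLeft (i j : ℕ) : (Nat.shiftLeft 1 i).testBit j = decide (i = j) := by
  rw [shiftLeft_eq, Nat.one_shiftLeft, Nat.testBit_two_pow]

/-- The number `m` with bit `i` set to zero. -/
def clearBit (m i : ℕ) : ℕ := Nat.xor m (Nat.land m (Nat.shiftLeft 1 i))

theorem testBit_clearBit (m i j : ℕ) :
    (clearBit m i).testBit j = (m.testBit j && !decide (i = j)) := by
  change (m ^^^ (m &&& Nat.shiftLeft 1 i)).testBit j = _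
  rw [Nat.testBit_xor, Nat.testBit_and, testBit_one_shiftLeft]
  cases m.testBit j <;> cases decide (i = j) <;> rfl

/-- Bitwise disjunction of `acc` and the numbers `f i`, where `i` runs over the set bits of `m`;
at most `k` of them are taken. -/
noncomputable def orBits (f : ℕ → ℕ) (k : ℕ) : ℕ → ℕ → ℕ :=
  Nat.rec (fun _ acc => acc)
    (fun _ ih m acc => Bool.rec
      (force (Nat.log2 m) fun i => ih (clearBit m i) (Nat.lor acc (f i)))
      acc (Nat.beq m 0)) k

theorem testBit_orBits (f : ℕ → ℕ) (k : ℕ) : ∀ (m acc : ℕ), m < 2 ^ k → ∀ t,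
    ((orBits f k m acc).testBit t = true ↔
      acc.testBit t = true ∨ ∃ i, m.testBit i = true ∧ (f i).testBit t = true) := by
  induction k with
  | zero =>
    intro m acc hm t
    have : m = 0 := by omega
    subst this
    change acc.testBit t = true ↔ _
    simp
  | succ k ih =>
    intro m acc hm t
    by_cases h0 : m = 0
    · subst h0
      change acc.testBit t = true ↔ _
      simp
    · have hb : Nat.beq m 0 = false := by
        cases h : Nat.beq m 0 with
        | false => rfl
        | true => exact absurd (Nat.eq_of_beq_eq_true h) h0
      have hlog : m.testBit m.log2 = true := Nat.testBit_log2 h0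
      have hlt : m.log2 < k + 1 := (Nat.log2_lt h0).2 hm
      have hm' : clearBit m m.log2 < 2 ^ k := by
        refine Nat.lt_pow_two_of_testBit _ fun j hj => ?_
        rw [testBit_clearBit]
        by_cases hj' : m.log2 = j
        · simp [hj']
        · have : k + 1 ≤ j ∨ m.log2 < j := by right; omega
          have h2 : m < 2 ^ j := (Nat.log2_lt h0).1 (by omega)
          rw [Nat.testBit_lt_two_pow h2, Bool.false_and]
      have hstep : orBits f (k + 1) m acc =
          Bool.rec (force (Nat.log2 m) fun i => orBits f k (clearBit m i) (Nat.lor acc (f i)))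
            acc (Nat.beq m 0) := rfl
      rw [hstep, hb]
      simp only [force_eq]
      rw [ih _ _ hm' t]
      change ((acc ||| f m.log2).testBit t = true ∨ _) ↔ _
      rw [Nat.testBit_or, Bool.or_eq_true, or_assoc]
      refine or_congr_right ?_
      constructor
      · rintro (h | ⟨i, hi, h⟩)
        · exact ⟨_, hlog, h⟩
        · rw [testBit_clearBit, Bool.and_eq_true] at hi
          exact ⟨i, hi.1, h⟩
      · rintro ⟨i, hi, h⟩
        by_cases hi' : m.log2 = i
        · exact Or.inl (hi' ▸ h)
        · refine Or.inr ⟨i, ?_, h⟩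
          rw [testBit_clearBit, hi, decide_eq_false hi']
          rfl

/-- The bit matrix with `n` rows whose row `i` is `f i`. -/
noncomputable def pack (f : ℕ → ℕ) (n : ℕ) : ℕ :=
  Nat.rec 0 (fun i ih => force ih fun acc =>
    Nat.lor acc (Nat.shiftLeft (Nat.land (f i) 4294967295) (Nat.mul 32 i))) n

theorem testBit_pack (f : ℕ → ℕ) (n i j : ℕ) (hj : j < 32) :
    (pack f n).testBit (32 * i + j) = (decide (i < n) && (f i).testBit j) := by
  induction n with
  | zero =>
    change Nat.testBit 0 _ = _
    simp
  | succ n ih =>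
    have hstep : pack f (n + 1) = pack f n ||| ((f n &&& (2 ^ 32 - 1)) <<< (32 * n)) := by
      change force (pack f n) (fun acc =>
        Nat.lor acc (Nat.shiftLeft (Nat.land (f n) 4294967295) (Nat.mul 32 n))) = _
      rw [force_eq]
      rfl
    rw [hstep, Nat.testBit_or, ih, Nat.testBit_shiftLeft, Nat.testBit_and,
      Nat.testBit_two_pow_sub_one]
    rcases lt_trichotomy i n with h | h | h
    · have h1 : ¬ (32 * i + j ≥ 32 * n) := by omega
      simp [h, h1, Nat.lt_succ_of_lt h]
    · subst h
      simp [hj]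
    · have h1 : ¬ (32 * i + j - 32 * n < 32) := by omega
      have h2 : ¬ (i < n + 1) := by omega
      simp [h1, h2, Nat.lt_asymm h]

theorem testBit_row_pack (f : ℕ → ℕ) (n i j : ℕ) :
    (row (pack f n) i).testBit j = true → i < n ∧ (f i).testBit j = true := by
  intro h
  rw [testBit_row, Bool.and_eq_true, decide_eq_true_eq] at h
  simpa [testBit_pack f n i j h.1] using h.2

/-- The number whose bits are exactly those at positions `i < n` with `p i`. -/
theorem exists_testBit_iff (n : ℕ) (p : ℕ → Prop) :
    ∃ m : ℕ, m < 2 ^ n ∧ ∀ i, m.testBit i = true ↔ i < n ∧ p i := by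
  classical
  have key : ∀ i, (Nat.ofBits fun i : Fin n => decide (p i)).testBit i = true ↔ i < n ∧ p i := by
    intro i
    by_cases hi : i < n
    · simp [Nat.testBit_ofBits_lt _ i hi, hi]
    · simp [Nat.testBit_ofBits_ge (fun i : Fin n => decide (p i)) i (by omega), hi]
  refine ⟨_, Nat.lt_pow_two_of_testBit _ fun i hi => ?_, key⟩
  by_contra h
  rw [Bool.not_eq_false, key] at h
  omega

end GraphCode

/-! ### Graphs without cycles of length four and five -/

/-- `G` has no cycle of length four or five, as a subgraph (induced or not). -/
structure NoShortCycle {V : Type*} (G : SimpleGraph V) : Prop where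
  four : ∀ a b c d, G.Adj a b → G.Adj b c → G.Adj c d → G.Adj d a → a ≠ c → b ≠ d → False
  five : ∀ a b c d e, G.Adj a b → G.Adj b c → G.Adj c d → G.Adj d e → G.Adj e a →
    a ≠ c → a ≠ d → b ≠ d → b ≠ e → c ≠ e → False

/-- `T` induces a graph of maximum degree at most one. -/
def InducesMatching {V : Type*} (G : SimpleGraph V) (T : Finset V) : Prop :=
  ∀ v ∈ T, ∀ a ∈ T, ∀ b ∈ T, G.Adj v a → G.Adj v b → a = b

/-- No `j`-subset of `W` induces a graph of maximum degree at most one. -/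
def NoSparse {V : Type*} (G : SimpleGraph V) (W : Finset V) (j : ℕ) : Prop :=
  ∀ T ⊆ W, T.card = j → ¬ InducesMatching G T

theorem NoSparse.mono {V : Type*} {G : SimpleGraph V} {W W' : Finset V} {j : ℕ}
    (h : NoSparse G W j) (hW : W' ⊆ W) : NoSparse G W' j :=
  fun T hT => h T (hT.trans hW)

namespace GraphCode

/-! ### Graphs encoded as bit matrices -/

/-- `f 0, …, f (n - 1)` are distinct vertices of `G`, and the number `A` is the bit matrix of
adjacency among them, with no further bits set. -/
structure IsCode {V : Type*} (G : SimpleGraph V) (f : ℕ → V) (n A : ℕ) : Prop where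
  inj : ∀ i < n, ∀ j < n, f i = f j → i = j
  adj : ∀ i j, j < 32 → (A.testBit (32 * i + j) = true ↔ i < n ∧ j < n ∧ G.Adj (f i) (f j))

theorem IsCode.testBit_row {V : Type*} {G : SimpleGraph V} {f : ℕ → V} {n A : ℕ}
    (h : IsCode G f n A) (hn : n ≤ 32) (i j : ℕ) :
    (row A i).testBit j = true ↔ i < n ∧ j < n ∧ G.Adj (f i) (f j) := by
  rw [GraphCode.testBit_row, Bool.and_eq_true, decide_eq_true_eq]
  constructor
  · rintro ⟨hj, h'⟩
    exact (h.adj i j hj).1 h'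
  · intro h'
    exact ⟨by omega, (h.adj i j (by omega)).2 h'⟩

/-- The code of the graph obtained from the graph on `n` vertices coded by `A` by adding a vertex
whose neighbours are the set bits of `S`. -/
noncomputable def extend (A n S : ℕ) : ℕ :=
  Nat.lor (Nat.lor A (Nat.shiftLeft S (Nat.mul 32 n)))
    (orBits (fun i => Nat.shiftLeft 1 (Nat.add (Nat.mul 32 i) n)) 32 S 0)

theorem isCode_extend {V : Type*} [DecidableEq V] {G : SimpleGraph V} {f : ℕ → V} {n A S : ℕ}
    (h : IsCode G f n A) (hn : n < 32) {x : V} (hx : ∀ i < n, f i ≠ x)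
    (hS : ∀ i, S.testBit i = true ↔ i < n ∧ G.Adj x (f i)) :
    IsCode G (Function.update f n x) (n + 1) (extend A n S) := by
  have hS32 : S < 2 ^ 32 := Nat.lt_pow_two_of_testBit _ fun i hi => by
    by_contra hc
    rw [Bool.not_eq_false, hS] at hc
    omega
  have hup : ∀ i < n, Function.update f n x i = f i := fun i hi =>
    Function.update_of_ne (by omega) _ _
  have hupn : Function.update f n x n = x := Function.update_self ..
  constructor
  · intro i hi j hj hij
    rcases Nat.lt_succ_iff_lt_or_eq.1 hi with hi | rfl <;>
      rcases Nat.lt_succ_iff_lt_or_eq.1 hj with hj | rfl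
    · rw [hup i hi, hup j hj] at hij
      exact h.inj i hi j hj hij
    · rw [hup i hi, hupn] at hij
      exact absurd hij (hx i hi)
    · rw [hup j hj, hupn] at hij
      exact absurd hij.symm (hx j hj)
    · rfl
  · intro i j hj
    have hdef : extend A n S = (A ||| S <<< (32 * n)) |||
        orBits (fun i => Nat.shiftLeft 1 (Nat.add (Nat.mul 32 i) n)) 32 S 0 := rfl
    rw [hdef, Nat.testBit_or, Nat.testBit_or, Bool.or_eq_true, Bool.or_eq_true, h.adj i j hj,
      testBit_orBits _ _ _ _ hS32, Nat.testBit_shiftLeft]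
    have hlast : (Nat.testBit 0 (32 * i + j) = true ∨ ∃ b, S.testBit b = true ∧
        (Nat.shiftLeft 1 (Nat.add (Nat.mul 32 b) n)).testBit (32 * i + j) = true) ↔
        j = n ∧ S.testBit i = true := by
      simp only [Nat.zero_testBit, Bool.false_eq_true, false_or, testBit_one_shiftLeft,
        decide_eq_true_eq]
      constructor
      · rintro ⟨b, hb, he⟩
        have he' : 32 * b + n = 32 * i + j := he
        obtain ⟨rfl, rfl⟩ : b = i ∧ j = n := by omega
        exact ⟨rfl, hb⟩
      · rintro ⟨rfl, hi⟩
        exact ⟨i, hi, rfl⟩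
    have hmid : (decide (32 * i + j ≥ 32 * n) && S.testBit (32 * i + j - 32 * n)) = true ↔
        i = n ∧ S.testBit j = true := by
      rw [Bool.and_eq_true, decide_eq_true_eq, hS, hS]
      constructor
      · rintro ⟨h1, h2, h3⟩
        obtain rfl : i = n := by omega
        rw [Nat.add_sub_cancel_left] at h2 h3
        exact ⟨rfl, h2, h3⟩
      · rintro ⟨rfl, h2⟩
        rw [Nat.add_sub_cancel_left]
        exact ⟨by omega, h2⟩
    rw [hlast, hmid, hS, hS]
    constructor
    · rintro ((⟨h1, h2, h3⟩ | ⟨rfl, h2, h3⟩) | ⟨rfl, h2, h3⟩)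
      · rw [hup i h1, hup j h2]
        exact ⟨by omega, by omega, h3⟩
      · rw [hupn, hup j h2]
        exact ⟨by omega, by omega, h3⟩
      · rw [hupn, hup i h2]
        exact ⟨by omega, by omega, h3.symm⟩
    · rintro ⟨hi, hj', hadj⟩
      rcases Nat.lt_succ_iff_lt_or_eq.1 hi with hi | rfl <;>
        rcases Nat.lt_succ_iff_lt_or_eq.1 hj' with hj' | rfl
      · rw [hup i hi, hup j hj'] at hadj
        exact Or.inl (Or.inl ⟨hi, hj', hadj⟩)
      · rw [hup i hi, hupn] at hadj
        exact Or.inr ⟨rfl, hi, hadj.symm⟩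
      · rw [hup j hj', hupn] at hadj
        exact Or.inl (Or.inr ⟨rfl, hj', hadj⟩)
      · exact absurd hadj (G.loopless.irrefl _)

/-! ### Possible neighbourhoods of a new vertex -/

/-- The vertices other than `i` at the end of a path of two or three edges from vertex `i`. -/
noncomputable def pathRow (A i : ℕ) : ℕ :=
  clearBit (orBits (fun p => force (clearBit (row A p) i) fun r =>
    Nat.lor r (orBits (fun q => clearBit (row A q) p) 32 r 0)) 32 (row A i) 0) i

theorem exists_path_of_testBit_pathRow {A i k : ℕ} (h : (pathRow A i).testBit k = true) :
    i ≠ k ∧ ∃ p, (row A i).testBit p = true ∧ ((row A p).testBit k = true ∨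
      ∃ q, i ≠ q ∧ (row A p).testBit q = true ∧ p ≠ k ∧ (row A q).testBit k = true) := by
  have hlt : ∀ p, clearBit (row A p) i < 2 ^ 32 := fun p => Nat.lt_pow_two_of_testBit _
    fun j hj => by rw [testBit_clearBit, Nat.testBit_lt_two_pow
      ((row_lt A p).trans_le (Nat.pow_le_pow_right (by omega) hj)), Bool.false_and]
  rw [pathRow, testBit_clearBit, Bool.and_eq_true, testBit_orBits _ _ _ _ (row_lt A i)] at h
  obtain ⟨h | ⟨p, hp, h⟩, hik⟩ := h
  · simp at h
  refine ⟨by simpa using hik, p, hp, ?_⟩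
  rw [force_eq] at h
  change (clearBit (row A p) i ||| orBits _ 32 (clearBit (row A p) i) 0).testBit k = true at h
  rw [Nat.testBit_or, Bool.or_eq_true, testBit_orBits _ _ _ _ (hlt p)] at h
  rcases h with h | h | ⟨q, hq, h⟩
  · rw [testBit_clearBit, Bool.and_eq_true] at h
    exact Or.inl h.1
  · simp at h
  · rw [testBit_clearBit, Bool.and_eq_true] at h hq
    exact Or.inr ⟨q, by simpa using hq.2, hq.1, by simpa using h.2, h.1⟩

/-- Prepends to `l` the sets obtained from `S` by adding bits below `n` and outside `M`, no two
of which are related by the matrix `P`; the bits set in `bad` are excluded from the start. -/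
noncomputable def nbhds (P M n : ℕ) : ℕ → ℕ → List ℕ → List ℕ :=
  Nat.rec (fun S _ l => S :: l)
    (fun i ih S bad l => Bool.rec
      (Bool.rec
        (force (Nat.lor S (Nat.shiftLeft 1 i)) fun S' => force (Nat.lor bad (row P i)) fun bad' =>
          ih S' bad' (ih S bad l))
        (ih S bad l) (hasBit bad i))
      (ih S bad l) (hasBit M i)) n

theorem nbhds_succ (P M i S bad : ℕ) (l : List ℕ) :
    nbhds P M (i + 1) S bad l =
      if M.testBit i || bad.testBit i then nbhds P M i S bad l
      else nbhds P M i (S ||| 1 <<< i) (bad ||| row P i) (nbhds P M i S bad l) := by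
  change (Bool.rec (Bool.rec (force (Nat.lor S (Nat.shiftLeft 1 i)) fun S' =>
      force (Nat.lor bad (row P i)) fun bad' => nbhds P M i S' bad' (nbhds P M i S bad l))
      (nbhds P M i S bad l) (hasBit bad i)) (nbhds P M i S bad l) (hasBit M i) : List ℕ) = _
  rw [hasBit_eq, hasBit_eq]
  cases M.testBit i <;> cases bad.testBit i <;> simp only [force_eq] <;> rfl

theorem subset_nbhds (P M n : ℕ) : ∀ S bad l, l ⊆ nbhds P M n S bad l := by
  induction n with
  | zero => intro S bad l; exact List.subset_cons_self _ _
  | succ n ih =>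
    intro S bad l
    rw [nbhds_succ]
    split_ifs
    · exact ih ..
    · exact List.Subset.trans (ih ..) (ih ..)

theorem mem_nbhds {P M T : ℕ}
    (hT : ∀ s t, T.testBit s = true → T.testBit t = true → ¬ (row P s).testBit t = true) (n : ℕ) :
    ∀ S bad l, (∀ b, S.testBit b = true ↔ T.testBit b = true ∧ (n ≤ b ∨ M.testBit b = true)) →
      (∀ b, bad.testBit b = true → ∃ s, S.testBit s = true ∧ (row P s).testBit b = true) →
      T ∈ nbhds P M n S bad l := by
  induction n with
  | zero =>
    intro S bad l hS _
    have : S = T := Nat.eq_of_testBit_eq fun b => by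
      rw [Bool.eq_iff_iff, hS]
      simp
    rw [this]
    exact List.mem_cons_self
  | succ n ih =>
    intro S bad l hS hbad
    have hnot : T.testBit n = true → M.testBit n = false → bad.testBit n = false := by
      intro hn hM
      by_contra hb
      obtain ⟨s, hs, hr⟩ := hbad n (by simpa using hb)
      exact hT s n ((hS s).1 hs).1 hn hr
    have hkeep : (T.testBit n = true → M.testBit n = true) →
        T ∈ nbhds P M n S bad l := fun hTn => ih _ _ _ (fun b => by
      rw [hS b]
      refine and_congr_right fun hb => ⟨?_, ?_⟩
      · rintro (h | h)
        · exact Or.inl (by omega)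
        · exact Or.inr h
      · rintro (h | h)
        · rcases Nat.eq_or_lt_of_le h with rfl | h
          · exact Or.inr (hTn hb)
          · exact Or.inl h
        · exact Or.inr h) hbad
    rw [nbhds_succ]
    split_ifs with hc
    · refine hkeep fun hn => ?_
      rw [Bool.or_eq_true] at hc
      rcases hc with hc | hc
      · exact hc
      · by_contra hM
        rw [hnot hn (by simpa using hM)] at hc
        exact Bool.false_ne_true hc
    · rw [Bool.or_eq_true, not_or] at hc
      by_cases hn : T.testBit n = true
      · refine ih _ _ _ (fun b => ?_) (fun b hb => ?_)
        · rw [Nat.testBit_or, Bool.or_eq_true, Nat.one_shiftLeft, Nat.testBit_two_pow,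
            decide_eq_true_eq, hS b]
          constructor
          · rintro (⟨h1, h2 | h2⟩ | rfl)
            · exact ⟨h1, Or.inl (by omega)⟩
            · exact ⟨h1, Or.inr h2⟩
            · exact ⟨hn, Or.inl le_rfl⟩
          · rintro ⟨h1, h2 | h2⟩
            · rcases Nat.eq_or_lt_of_le h2 with rfl | h2
              · exact Or.inr rfl
              · exact Or.inl ⟨h1, Or.inl h2⟩
            · exact Or.inl ⟨h1, Or.inr h2⟩
        · have hSn : (S ||| 1 <<< n).testBit n = true := by
            rw [Nat.testBit_or, Nat.one_shiftLeft, Nat.testBit_two_pow]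
            simp
          rw [Nat.testBit_or, Bool.or_eq_true] at hb
          rcases hb with hb | hb
          · obtain ⟨s, hs, hr⟩ := hbad b hb
            exact ⟨s, by rw [Nat.testBit_or, hs, Bool.true_or], hr⟩
          · exact ⟨n, hSn, hb⟩
      · exact subset_nbhds _ _ _ _ _ _ (hkeep fun h => absurd h hn)

/-- The possible neighbourhoods of a vertex added to the graph on `n` vertices coded by `A`, if
no cycle of length four or five may arise and the neighbours in the set `M` are those in `F`. -/
noncomputable def candidates (A n M F : ℕ) : List ℕ :=
  force (pack (pathRow A) n) fun P => force (orBits (row P) 32 F 0) fun bad => nbhds P M n F bad []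

theorem mem_candidates {V : Type*} {G : SimpleGraph V} (hG : NoShortCycle G) {f : ℕ → V}
    {n A M F T : ℕ} (h : IsCode G f n A) (hn : n ≤ 32) {x : V} (hx : ∀ i < n, f i ≠ x)
    (hT : ∀ i, T.testBit i = true ↔ i < n ∧ G.Adj x (f i))
    (hF : ∀ i, F.testBit i = true ↔ i < n ∧ M.testBit i = true ∧ G.Adj x (f i)) :
    T ∈ candidates A n M F := by
  have hF32 : F < 2 ^ 32 := Nat.lt_pow_two_of_testBit _ fun i hi => by
    by_contra hc
    rw [Bool.not_eq_false, hF] at hc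
    omega
  rw [candidates, force_eq, force_eq]
  refine mem_nbhds (fun s t hs ht hst => ?_) n _ _ _ (fun b => ?_) fun b hb => ?_
  · obtain ⟨hs, hxs⟩ := (hT s).1 hs
    obtain ⟨ht, hxt⟩ := (hT t).1 ht
    obtain ⟨hne, p, hp, hq⟩ := exists_path_of_testBit_pathRow (testBit_row_pack _ _ _ _ hst).2
    have hne' : f s ≠ f t := fun he => hne (h.inj s hs t ht he)
    obtain ⟨-, hp, hsp⟩ := (h.testBit_row hn s p).1 hp
    rcases hq with hq | ⟨q, hsq, hpq, hpt, hqt⟩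
    · obtain ⟨-, -, hpt⟩ := (h.testBit_row hn p t).1 hq
      exact hG.four x (f s) (f p) (f t) hxs hsp hpt hxt.symm (hx p hp).symm hne'
    · obtain ⟨-, hq, hpq⟩ := (h.testBit_row hn p q).1 hpq
      obtain ⟨-, -, hqt⟩ := (h.testBit_row hn q t).1 hqt
      exact hG.five x (f s) (f p) (f q) (f t) hxs hsp hpq hqt hxt.symm (hx p hp).symm
        (hx q hq).symm (fun he => hsq (h.inj s hs q hq he)) hne'
        (fun he => hpt (h.inj p hp t ht he))
  · rw [hF, hT]
    constructor
    · rintro ⟨h1, h2, h3⟩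
      exact ⟨⟨h1, h3⟩, Or.inr h2⟩
    · rintro ⟨⟨h1, h3⟩, h2 | h2⟩
      · omega
      · exact ⟨h1, h2, h3⟩
  · rw [testBit_orBits _ _ _ _ hF32] at hb
    rcases hb with hb | hb
    · simp at hb
    · exact hb

end GraphCode

namespace GraphCode

/-! ### Sets inducing a matching -/

/-- The number of set bits of `x`, for `x < 2 ^ 32`, by parallel addition. -/
noncomputable def popCount (x : ℕ) : ℕ :=
  force (Nat.sub x (Nat.land (Nat.shiftRight x 1) 0x55555555)) fun x =>
  force (Nat.add (Nat.land x 0x33333333) (Nat.land (Nat.shiftRight x 2) 0x33333333)) fun x =>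
  force (Nat.land (Nat.add x (Nat.shiftRight x 4)) 0x0f0f0f0f) fun x =>
  Nat.land (Nat.shiftRight (Nat.mul x 0x01010101) 24) 255

/-- The list `b`, or `a` if `b` is empty. -/
def orElse (a b : List ℕ) : List ℕ := List.rec a (fun x l _ => x :: l) b

/-- The part of `sparseSearch` that takes the vertex `v`, with neighbourhood `r`, into the set. -/
noncomputable def sparseSearchTake (A : ℕ) (search : ℕ → ℕ → ℕ → ℕ → List ℕ → List ℕ)
    (c U N need : ℕ) (T : List ℕ) (v r : ℕ) : List ℕ :=
  Bool.rec
    (search (Nat.sub c (Nat.land c (Nat.lor r (row A (Nat.log2 (Nat.land r U)))))) U N need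
      (v :: T))
    (search (Nat.sub c (Nat.land c (Nat.land r N))) (Nat.lor U (Nat.shiftLeft 1 v)) (Nat.lor N r)
      need (v :: T))
    (Nat.beq (Nat.land r U) 0)

/-- The part of `sparseSearch` that branches on the vertex `v`. -/
noncomputable def sparseSearchBranch (A : ℕ) (search : ℕ → ℕ → ℕ → ℕ → List ℕ → List ℕ)
    (cand U N need : ℕ) (T : List ℕ) (v : ℕ) : List ℕ :=
  orElse (search (Nat.sub cand (Nat.shiftLeft 1 v)) U N need T)
    (force (row A v) (sparseSearchTake A search (Nat.sub cand (Nat.shiftLeft 1 v)) U N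
      (Nat.sub need 1) T v))

/-- Looks for `need` vertices in `cand` that extend the list `T` to a set inducing a matching, and
returns the longer list, or the empty list. Here `U` is the set of isolated vertices of the graph
induced on `T`, and `N` contains their neighbourhoods. Nothing is proved about this search: a
list that it returns is checked afterwards. -/
noncomputable def sparseSearch (A k : ℕ) : ℕ → ℕ → ℕ → ℕ → List ℕ → List ℕ :=
  Nat.rec (fun _ _ _ need T => Bool.rec [] T (Nat.beq need 0))
    (fun _ ih cand U N need T => force cand fun cand => Bool.rec
      (Bool.rec [] (force (Nat.log2 cand) (sparseSearchBranch A ih cand U N need T))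
        (Nat.ble need (popCount cand)))
      T (Nat.beq need 0)) k

/-- A list of `j` vertices including the last vertex `n` and inducing a matching, if the search
finds one. For `j = 0` the result is the list `[n]`. -/
noncomputable def findSparse (A n j : ℕ) : List ℕ :=
  sparseSearch A (n + 1) (Nat.sub (Nat.shiftLeft 1 n) 1) (Nat.shiftLeft 1 n) (row A n)
    (Nat.sub j 1) [n]

/-- The number whose set bits are the members of `T`. -/
noncomputable def maskOf (T : List ℕ) : ℕ :=
  List.rec 0 (fun a _ ih => force ih fun m => Nat.lor (Nat.shiftLeft 1 a) m) T

theorem testBit_maskOf (T : List ℕ) (i : ℕ) : (maskOf T).testBit i = true ↔ i ∈ T := by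
  induction T with
  | nil =>
    change Nat.testBit 0 i = true ↔ _
    simp
  | cons a T ih =>
    have hstep : maskOf (a :: T) = Nat.shiftLeft 1 a ||| maskOf T := by
      change force (maskOf T) (fun m => Nat.lor (Nat.shiftLeft 1 a) m) = _
      rw [force_eq]
      rfl
    rw [hstep, Nat.testBit_or, Bool.or_eq_true, testBit_one_shiftLeft, ih, decide_eq_true_eq,
      List.mem_cons]
    exact or_congr_left eq_comm

/-- Whether `T` is increasing with members between `lo` and `n - 1`, each with at most one
neighbour in the set `m`. -/
noncomputable def checkDegrees (A n m : ℕ) (T : List ℕ) : ℕ → Bool :=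
  List.rec (fun lo => Nat.ble lo n)
    (fun v _ ih lo => Bool.rec false
      (force (Nat.land (row A v) m) fun w =>
        Bool.rec (Bool.rec false (ih (Nat.succ v)) (Nat.beq w (Nat.shiftLeft 1 (Nat.log2 w))))
          (ih (Nat.succ v)) (Nat.beq w 0))
      (Nat.ble lo v)) T

theorem of_checkDegrees {A n m : ℕ} (T : List ℕ) : ∀ lo, checkDegrees A n m T lo = true →
    lo ≤ n ∧ T.Pairwise (· < ·) ∧ ∀ v ∈ T, lo ≤ v ∧ v < n ∧ ∀ a b,
      (row A v &&& m).testBit a = true → (row A v &&& m).testBit b = true → a = b := by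
  induction T with
  | nil =>
    intro lo h
    exact ⟨Nat.le_of_ble_eq_true h, List.Pairwise.nil, by simp⟩
  | cons v T ih =>
    intro lo h
    have hstep : checkDegrees A n m (v :: T) lo = Bool.rec false
        (force (Nat.land (row A v) m) fun w =>
          Bool.rec (Bool.rec false (checkDegrees A n m T (v + 1))
            (Nat.beq w (Nat.shiftLeft 1 (Nat.log2 w))))
          (checkDegrees A n m T (v + 1)) (Nat.beq w 0)) (Nat.ble lo v) := rfl
    rw [hstep, force_eq] at h
    have hlo : Nat.ble lo v = true := by
      by_contra hc
      rw [Bool.not_eq_true] at hc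
      rw [hc] at h
      exact Bool.false_ne_true h
    rw [hlo] at h
    replace h : (Bool.rec (Bool.rec false (checkDegrees A n m T (v + 1))
      (Nat.beq (row A v &&& m) (Nat.shiftLeft 1 (Nat.log2 (row A v &&& m)))))
      (checkDegrees A n m T (v + 1)) (Nat.beq (row A v &&& m) 0) : Bool) = true := h
    have key : checkDegrees A n m T (v + 1) = true ∧ ∀ a b,
        (row A v &&& m).testBit a = true → (row A v &&& m).testBit b = true → a = b := by
      cases h0 : Nat.beq (row A v &&& m) 0 with
      | true =>
        rw [h0] at h
        refine ⟨h, fun a b ha => ?_⟩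
        rw [Nat.eq_of_beq_eq_true h0, Nat.zero_testBit] at ha
        exact absurd ha Bool.false_ne_true
      | false =>
        rw [h0] at h
        cases h1 : Nat.beq (row A v &&& m) (Nat.shiftLeft 1 (Nat.log2 (row A v &&& m))) with
        | false =>
          rw [h1] at h
          exact absurd h Bool.false_ne_true
        | true =>
          rw [h1] at h
          refine ⟨h, fun a b ha hb => ?_⟩
          rw [Nat.eq_of_beq_eq_true h1, testBit_one_shiftLeft, decide_eq_true_eq] at ha hb
          exact ha.symm.trans hb
    obtain ⟨h1, h2, h3⟩ := ih _ key.1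
    have hlo' := Nat.le_of_ble_eq_true hlo
    refine ⟨by omega, List.Pairwise.cons (fun b hb => (h3 b hb).1) h2, ?_⟩
    intro u hu
    rcases List.mem_cons.1 hu with rfl | hu
    · exact ⟨hlo', by omega, key.2⟩
    · exact ⟨by have := (h3 u hu).1; omega, (h3 u hu).2⟩

/-- Whether `T` consists of `j` vertices inducing a matching. -/
noncomputable def checkSparse (A n j : ℕ) (T : List ℕ) : Bool :=
  Bool.rec false (force (maskOf T) fun m => checkDegrees A n m T 0) (Nat.beq T.length j)

theorem checkSparse_findSparse_zero (A n m : ℕ) :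
    checkSparse A m 0 (findSparse A n 0) = false := by
  have : findSparse A n 0 = [n] := by
    unfold findSparse sparseSearch
    dsimp only
    rw [force_eq]
    rfl
  rw [this]
  rfl

theorem not_noSparse_of_checkSparse {V : Type*} [DecidableEq V] {G : SimpleGraph V} {f : ℕ → V}
    {n A j : ℕ} {T : List ℕ} (hA : IsCode G f n A) (hn : n ≤ 32)
    (h : checkSparse A n j T = true) : ¬ NoSparse G ((Finset.range n).image f) j := by
  rw [checkSparse, force_eq] at h
  have hlen : Nat.beq T.length j = true := by
    by_contra hc
    rw [Bool.not_eq_true] at hc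
    rw [hc] at h
    exact Bool.false_ne_true h
  rw [hlen] at h
  obtain ⟨-, hlt, hT⟩ := of_checkDegrees T 0 h
  have hnodup : T.Nodup := hlt.imp fun h => h.ne
  have hmem : ∀ v, v ∈ (T.toFinset).image f ↔ ∃ i ∈ T, f i = v := by simp
  intro hno
  refine hno (T.toFinset.image f) ?_ ?_ ?_
  · intro v hv
    obtain ⟨i, hi, rfl⟩ := (hmem v).1 hv
    exact Finset.mem_image_of_mem _ (Finset.mem_range.2 (hT i hi).2.1)
  · rw [Finset.card_image_of_injOn, List.toFinset_card_of_nodup hnodup,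
      Nat.eq_of_beq_eq_true hlen]
    intro a ha b hb hab
    exact hA.inj a (hT a (by simpa using ha)).2.1 b (hT b (by simpa using hb)).2.1 hab
  · intro v hv a ha b hb hva hvb
    obtain ⟨v, hvT, rfl⟩ := (hmem v).1 hv
    obtain ⟨a, haT, rfl⟩ := (hmem a).1 ha
    obtain ⟨b, hbT, rfl⟩ := (hmem b).1 hb
    have hbit : ∀ c ∈ T, G.Adj (f v) (f c) → (row A v &&& maskOf T).testBit c = true := by
      intro c hc hvc
      rw [Nat.testBit_and, Bool.and_eq_true]
      exact ⟨(hA.testBit_row hn v c).2 ⟨(hT v hvT).2.1, (hT c hc).2.1, hvc⟩,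
        (testBit_maskOf T c).2 hc⟩
    rw [(hT v hvT).2.2 a b (hbit a haT hva) (hbit b hbT hvb)]

/-! ### One-vertex extensions -/

/-- Prepends to `acc` the extensions of `A` by a vertex with neighbourhood in `L`, except those in
which a set of `j` vertices inducing a matching is found. -/
noncomputable def extendAll (j n A : ℕ) (L acc : List ℕ) : List ℕ :=
  List.rec acc (fun S _ ih => force (extend A n S) fun A' =>
    Bool.rec (A' :: ih) ih (checkSparse A' (n + 1) j (findSparse A' n j))) L

theorem extendAll_cons (j n A S : ℕ) (L acc : List ℕ) :
    extendAll j n A (S :: L) acc =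
      if checkSparse (extend A n S) (n + 1) j (findSparse (extend A n S) n j) then
        extendAll j n A L acc
      else extend A n S :: extendAll j n A L acc := by
  change force (extend A n S) (fun A' => (Bool.rec (A' :: extendAll j n A L acc)
    (extendAll j n A L acc) (checkSparse A' (n + 1) j (findSparse A' n j)) : List ℕ)) = _
  rw [force_eq]
  cases checkSparse (extend A n S) (n + 1) j (findSparse (extend A n S) n j) <;> rfl

theorem subset_extendAll (j n A : ℕ) (L acc : List ℕ) : acc ⊆ extendAll j n A L acc := by
  induction L with
  | nil => exact List.Subset.refl _
  | cons S L ih =>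
    rw [extendAll_cons]
    split_ifs
    · exact ih
    · exact List.subset_cons_of_subset _ ih

theorem mem_extendAll {j n A S : ℕ} {L : List ℕ} (hS : S ∈ L)
    (h : ¬ checkSparse (extend A n S) (n + 1) j (findSparse (extend A n S) n j) = true)
    (acc : List ℕ) : extend A n S ∈ extendAll j n A L acc := by
  induction L with
  | nil => simp at hS
  | cons S' L ih =>
    rw [extendAll_cons]
    rcases List.mem_cons.1 hS with rfl | hS
    · rw [if_neg h]
      exact List.mem_cons_self
    · split_ifs
      · exact ih hS
      · exact List.mem_cons_of_mem _ (ih hS)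

/-- The extensions of the graphs in `L`, which have `n` vertices, by a vertex whose neighbours in
the set `M` are those in `F`, such that no cycle of length four or five arises and no set of `j`
vertices inducing a matching is found. For `j = 0` there is no search for such sets. -/
noncomputable def extensions (j n M F : ℕ) (L : List ℕ) : List ℕ :=
  List.rec [] (fun A _ ih => extendAll j n A (candidates A n M F) ih) L

theorem mem_extensions {j n M F A S : ℕ} {L : List ℕ} (hA : A ∈ L) (hS : S ∈ candidates A n M F)
    (h : ¬ checkSparse (extend A n S) (n + 1) j (findSparse (extend A n S) n j) = true) :
    extend A n S ∈ extensions j n M F L := by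
  induction L with
  | nil => simp at hA
  | cons A' L ih =>
    change _ ∈ extendAll j n A' (candidates A' n M F) (extensions j n M F L)
    rcases List.mem_cons.1 hA with rfl | hA
    · exact mem_extendAll hS h _
    · exact subset_extendAll _ _ _ _ _ (ih hA)

theorem exists_mem_extensions {V : Type*} [DecidableEq V] {G : SimpleGraph V}
    (hG : NoShortCycle G) {f : ℕ → V} {j n M F : ℕ} {L : List ℕ} (hL : ∃ A ∈ L, IsCode G f n A)
    (hn : n < 32) {x : V} (hx : ∀ i < n, f i ≠ x)
    (hF : ∀ i, F.testBit i = true ↔ i < n ∧ M.testBit i = true ∧ G.Adj x (f i))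
    (hj : j ≠ 0 → NoSparse G (insert x ((Finset.range n).image f)) j) :
    ∃ A ∈ extensions j n M F L, IsCode G (Function.update f n x) (n + 1) A := by
  obtain ⟨A, hA, hc⟩ := hL
  obtain ⟨S, -, hS⟩ := exists_testBit_iff n fun i => G.Adj x (f i)
  have hc' := isCode_extend hc hn hx hS
  refine ⟨_, mem_extensions hA (mem_candidates hG hc hn.le hx hS hF) fun hs => ?_, hc'⟩
  rcases eq_or_ne j 0 with rfl | hj0
  · rw [checkSparse_findSparse_zero] at hs
    exact Bool.false_ne_true hs
  · refine not_noSparse_of_checkSparse hc' hn hs ((hj hj0).mono fun v hv => ?_)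
    obtain ⟨i, hi, rfl⟩ := Finset.mem_image.1 hv
    rcases Nat.lt_succ_iff_lt_or_eq.1 (Finset.mem_range.1 hi) with hi | rfl
    · rw [Function.update_of_ne (by omega)]
      exact Finset.mem_insert_of_mem (Finset.mem_image_of_mem _ (Finset.mem_range.2 hi))
    · rw [Function.update_self]
      exact Finset.mem_insert_self _ _

/-! ### Isomorphisms -/

/-- The sum of `acc` and the numbers `f i`, where `i` runs over the set bits of `m`; at most `k`
of them are taken. -/
noncomputable def sumBits (f : ℕ → ℕ) (k : ℕ) : ℕ → ℕ → ℕ :=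
  Nat.rec (fun _ acc => acc)
    (fun _ ih m acc => Bool.rec
      (force (Nat.log2 m) fun i => ih (clearBit m i) (Nat.add acc (f i)))
      acc (Nat.beq m 0)) k

/-- One round of refinement of the vertex labels `P` by the labels of the neighbours. -/
noncomputable def refineLabels (A n P : ℕ) : ℕ :=
  pack (fun v => Nat.land (Nat.add (Nat.mul 7 (row P v))
    (sumBits (fun w => force (Nat.add 3 (row P w)) fun x => Nat.mul (Nat.mul x x) x)
      32 (row A v) 0)) 65535) n

/-- Vertex labels invariant under isomorphism, starting from the degrees. -/
noncomputable def labels (A n : ℕ) : ℕ :=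
  force (pack (fun v => popCount (row A v)) n) fun P => force (refineLabels A n P) fun P =>
    force (refineLabels A n P) fun P => refineLabels A n P

/-- The set of vertices with label `c`. -/
noncomputable def labelClass (P c n : ℕ) : ℕ :=
  Nat.rec 0 (fun i ih => force ih fun acc =>
    Bool.rec acc (Nat.lor acc (Nat.shiftLeft 1 i)) (Nat.beq (row P i) c)) n

/-- The vertices of `A` in the set `c` to which a vertex with neighbourhood `r` may be mapped, if
the vertices `k < i` are mapped to the entries `row Q k`. -/
noncomputable def compatible (A r Q c i : ℕ) : ℕ :=
  Nat.rec c (fun k ih => force ih fun c => force (row A (row Q k)) fun s =>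
    Bool.rec (Nat.sub c (Nat.land c s)) (Nat.land c s) (hasBit r k)) i

/-- The first nonzero value of `g v (2 ^ v)`, where `v` runs over the set bits of a number. -/
noncomputable def firstNonzero (g : ℕ → ℕ → ℕ) (k : ℕ) : ℕ → ℕ :=
  Nat.rec (fun _ => 0)
    (fun _ ih c => Bool.rec
      (force (Nat.log2 c) fun v => force (Nat.shiftLeft 1 v) fun b =>
        force (g v b) fun r => Bool.rec r (ih (Nat.sub c b)) (Nat.beq r 0))
      0 (Nat.beq c 0)) k

/-- Looks for an isomorphism from `B` to `A` extending the map `Q` on the vertices below `i`, and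
returns the list of its values as the rows of a bit matrix. Nothing is proved about this search:
the matrix that it returns is checked afterwards. -/
noncomputable def isoSearch (B A n PB PA : ℕ) (k : ℕ) : ℕ → ℕ → ℕ → ℕ :=
  Nat.rec (fun _ _ Q => Q)
    (fun _ ih i used Q =>
      force (labelClass PA (row PB i) n) fun c => force (Nat.sub c (Nat.land c used)) fun c =>
      force (compatible A (row B i) Q c i) fun c =>
      firstNonzero (fun v b => force (Nat.lor used b) fun used' =>
        force (Nat.lor Q (Nat.shiftLeft v (Nat.mul 32 i))) fun Q' => ih (Nat.succ i) used' Q') n c)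
    k

/-- Whether, for the first `k` vertices of `B`, the map `Q` sends the neighbours of a vertex
exactly to the neighbours of its image in `A`. -/
noncomputable def checkRows (B A Q n : ℕ) (k : ℕ) : Bool :=
  Nat.rec true (fun i ih => Bool.rec false
    (Bool.rec false ih
      (Nat.beq (orBits (fun l => Nat.shiftLeft 1 (row Q l)) 32 (row B i) 0) (row A (row Q i))))
    (Nat.ble (Nat.succ (row B i)) (Nat.shiftLeft 1 n))) k

theorem of_checkRows {B A Q n : ℕ} (k : ℕ) (h : checkRows B A Q n k = true) :
    ∀ i < k, row B i < 2 ^ n ∧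
      orBits (fun l => Nat.shiftLeft 1 (row Q l)) 32 (row B i) 0 = row A (row Q i) := by
  induction k with
  | zero => intro i hi; omega
  | succ k ih =>
    have hstep : checkRows B A Q n (k + 1) = Bool.rec false
      (Bool.rec false (checkRows B A Q n k)
        (Nat.beq (orBits (fun l => Nat.shiftLeft 1 (row Q l)) 32 (row B k) 0) (row A (row Q k))))
      (Nat.ble (Nat.succ (row B k)) (Nat.shiftLeft 1 n)) := rfl
    rw [hstep] at h
    cases h1 : Nat.ble (Nat.succ (row B k)) (Nat.shiftLeft 1 n) with
    | false =>
      rw [h1] at h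
      exact absurd h Bool.false_ne_true
    | true =>
      rw [h1] at h
      cases h2 : Nat.beq (orBits (fun l => Nat.shiftLeft 1 (row Q l)) 32 (row B k) 0)
          (row A (row Q k)) with
      | false =>
        rw [h2] at h
        exact absurd h Bool.false_ne_true
      | true =>
        rw [h2] at h
        intro i hi
        rcases Nat.lt_succ_iff_lt_or_eq.1 hi with hi | rfl
        · exact ih h i hi
        · refine ⟨?_, Nat.eq_of_beq_eq_true h2⟩
          have := Nat.le_of_ble_eq_true h1
          rwa [shiftLeft_eq, Nat.one_shiftLeft] at this

/-- The set of all `n` vertices. -/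
def full (n : ℕ) : ℕ := Nat.sub (Nat.shiftLeft 1 n) 1

theorem full_eq (n : ℕ) : full n = 2 ^ n - 1 := by
  change Nat.shiftLeft 1 n - 1 = _
  rw [shiftLeft_eq, Nat.one_shiftLeft]

theorem testBit_full (n i : ℕ) : (full n).testBit i = decide (i < n) := by
  rw [full_eq, Nat.testBit_two_pow_sub_one]

/-- Whether the rows of `Q` are the values of an isomorphism from `B` to `A`. -/
noncomputable def checkIso (B A n Q : ℕ) : Bool :=
  Bool.rec false
    (Bool.rec false (checkRows B A Q n n)
      (Nat.beq (orBits (fun l => Nat.shiftLeft 1 (row Q l)) 32 (full n) 0) (full n)))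
    (Nat.ble (Nat.succ B) (Nat.shiftLeft 1 (Nat.mul 32 n)))

theorem isCode_of_checkIso {V : Type*} [DecidableEq V] {G : SimpleGraph V} {f : ℕ → V}
    {n A B Q : ℕ} (hA : IsCode G f n A) (hn : n ≤ 32) (h : checkIso B A n Q = true) :
    IsCode G (fun i => f (row Q i)) n B ∧
      (Finset.range n).image (fun i => f (row Q i)) = (Finset.range n).image f := by
  rw [checkIso] at h
  cases h1 : Nat.ble (Nat.succ B) (Nat.shiftLeft 1 (Nat.mul 32 n)) with
  | false =>
    rw [h1] at h
    exact absurd h Bool.false_ne_true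
  | true =>
  rw [h1] at h
  cases h2 : Nat.beq (orBits (fun l => Nat.shiftLeft 1 (row Q l)) 32 (full n) 0) (full n) with
  | false =>
    rw [h2] at h
    exact absurd h Bool.false_ne_true
  | true =>
  rw [h2] at h
  have hB : B < 2 ^ (32 * n) := by
    have := Nat.le_of_ble_eq_true h1
    rwa [shiftLeft_eq, Nat.one_shiftLeft] at this
  have hrows := of_checkRows n h
  have hfull : full n < 2 ^ 32 := by
    rw [full_eq]
    have := Nat.pow_le_pow_right (n := 2) (by omega) hn
    have := Nat.two_pow_pos n
    omega
  have himg : (Finset.range n).image (row Q) = Finset.range n := by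
    ext t
    have := testBit_orBits (fun l => Nat.shiftLeft 1 (row Q l)) 32 (full n) 0 hfull t
    rw [Nat.eq_of_beq_eq_true h2, testBit_full, decide_eq_true_eq] at this
    rw [Finset.mem_range, this]
    simp only [testBit_full, testBit_one_shiftLeft, decide_eq_true_eq, Finset.mem_image,
      Finset.mem_range, Nat.zero_testBit, Bool.false_eq_true, false_or]
  have hQ : ∀ i < n, row Q i < n := fun i hi =>
    Finset.mem_range.1 (himg ▸ Finset.mem_image_of_mem _ (Finset.mem_range.2 hi))
  have hinj : ∀ i < n, ∀ j < n, row Q i = row Q j → i = j := by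
    have := Finset.card_image_iff.1 (congrArg Finset.card himg)
    intro i hi j hj hij
    exact this (by simpa using hi) (by simpa using hj) hij
  refine ⟨⟨fun i hi j hj hij => hinj i hi j hj (hA.inj _ (hQ i hi) _ (hQ j hj) hij), ?_⟩, ?_⟩
  · intro i j hj
    have hrow : ∀ i < n, ∀ t, (row A (row Q i)).testBit t = true ↔
        ∃ l, (row B i).testBit l = true ∧ row Q l = t := by
      intro i hi t
      rw [← (hrows i hi).2, testBit_orBits _ _ _ _ (row_lt B i)]
      simp only [testBit_one_shiftLeft, decide_eq_true_eq, Nat.zero_testBit, Bool.false_eq_true,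
        false_or]
    have hlt : ∀ i < n, ∀ l, (row B i).testBit l = true → l < n := by
      intro i hi l hl
      by_contra hc
      rw [Nat.testBit_lt_two_pow ((hrows i hi).1.trans_le
        (Nat.pow_le_pow_right (by omega) (by omega)))] at hl
      exact Bool.false_ne_true hl
    have hBrow : (row B i).testBit j = B.testBit (32 * i + j) := by
      rw [testBit_row, decide_eq_true hj, Bool.true_and]
    rw [← hBrow]
    constructor
    · intro hb
      have hi : i < n := by
        by_contra hc
        rw [hBrow, Nat.testBit_lt_two_pow (hB.trans_le
          (Nat.pow_le_pow_right (by omega) (by omega)))] at hb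
        exact Bool.false_ne_true hb
      have hbit := (hrow i hi (row Q j)).2 ⟨j, hb, rfl⟩
      exact ⟨hi, hlt i hi j hb, ((hA.testBit_row hn _ _).1 hbit).2.2⟩
    · rintro ⟨hi, hj, hadj⟩
      obtain ⟨l, hl, hlj⟩ := (hrow i hi (row Q j)).1
        ((hA.testBit_row hn _ _).2 ⟨hQ i hi, hQ j hj, hadj⟩)
      rwa [← hinj l (hlt i hi l hl) j hj hlj]
  · have : (fun i => f (row Q i)) = f ∘ row Q := rfl
    rw [this, ← Finset.image_image, himg]

/-- Whether an isomorphism from `B` to `A` is found. -/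
noncomputable def isoTo (B A n : ℕ) : Bool :=
  force (labels A n) fun PA => force (labels B n) fun PB =>
    force (isoSearch B A n PB PA n 0 0 0) fun Q => checkIso B A n Q

/-- Whether `A` is found to be isomorphic to a member of `L`. -/
noncomputable def memIso (n A : ℕ) (L : List ℕ) : Bool :=
  List.rec false (fun B _ ih => Bool.rec ih true (isoTo B A n)) L

/-- Whether every member of `L` is found to be isomorphic to a member of `L'`. -/
noncomputable def allMemIso (n : ℕ) (L' L : List ℕ) : Bool :=
  List.rec true (fun A _ ih => Bool.rec false ih (memIso n A L')) L

theorem exists_isoTo_of_memIso {n A : ℕ} {L : List ℕ} (h : memIso n A L = true) :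
    ∃ B ∈ L, isoTo B A n = true := by
  induction L with
  | nil => exact absurd h Bool.false_ne_true
  | cons B L ih =>
    have hstep : memIso n A (B :: L) = Bool.rec (memIso n A L) true (isoTo B A n) := rfl
    cases hB : isoTo B A n with
    | true => exact ⟨B, List.mem_cons_self, hB⟩
    | false =>
      rw [hstep, hB] at h
      obtain ⟨B', hB', h'⟩ := ih h
      exact ⟨B', List.mem_cons_of_mem _ hB', h'⟩

theorem memIso_of_allMemIso {n A : ℕ} {L' L : List ℕ} (h : allMemIso n L' L = true)
    (hA : A ∈ L) : memIso n A L' = true := by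
  induction L with
  | nil => simp at hA
  | cons B L ih =>
    have hstep : allMemIso n L' (B :: L) =
      Bool.rec false (allMemIso n L' L) (memIso n B L') := rfl
    cases hB : memIso n B L' with
    | false =>
      rw [hstep, hB] at h
      exact absurd h Bool.false_ne_true
    | true =>
      rw [hstep, hB] at h
      rcases List.mem_cons.1 hA with rfl | hA
      · exact hB
      · exact ih h hA

/-- `L` contains a code of the graph induced on the set `W` of `n` vertices. -/
def Represents {V : Type*} [DecidableEq V] (G : SimpleGraph V) (W : Finset V) (n : ℕ)
    (L : List ℕ) : Prop :=
  ∃ f : ℕ → V, (Finset.range n).image f = W ∧ ∃ A ∈ L, IsCode G f n A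

theorem Represents.of_allMemIso {V : Type*} [DecidableEq V] {G : SimpleGraph V} {W : Finset V}
    {n : ℕ} {L L' : List ℕ} (h : Represents G W n L) (hn : n ≤ 32)
    (hL : allMemIso n L' L = true) : Represents G W n L' := by
  obtain ⟨f, hf, A, hA, hc⟩ := h
  obtain ⟨B, hB, hiso⟩ := exists_isoTo_of_memIso (memIso_of_allMemIso hL hA)
  rw [isoTo, force_eq, force_eq, force_eq] at hiso
  obtain ⟨h1, h2⟩ := isCode_of_checkIso hc hn hiso
  exact ⟨_, h2.trans hf, B, hB, h1⟩

end GraphCode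

/-! ### Counting vertices around an edge or a triangle -/

section Counting

open Classical in
/-- The neighbours of `v` in the set `W`. -/
noncomputable def nbrs {V : Type*} (G : SimpleGraph V) (W : Finset V) (v : V) : Finset V :=
  W.filter (G.Adj v)

theorem mem_nbrs {V : Type*} {G : SimpleGraph V} {W : Finset V} {v x : V} :
    x ∈ nbrs G W v ↔ x ∈ W ∧ G.Adj v x := by
  simp [nbrs]

variable {V : Type*} [DecidableEq V] {G : SimpleGraph V} {W : Finset V}

theorem card_nbrs_inter_le_one (hG : NoShortCycle G) {x y : V} (hxy : x ≠ y) :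
    (nbrs G W x ∩ nbrs G W y).card ≤ 1 := by
  rw [Finset.card_le_one]
  intro a ha b hb
  rw [Finset.mem_inter, mem_nbrs, mem_nbrs] at ha hb
  by_contra hab
  exact hG.four x a y b ha.1.2 ha.2.2.symm hb.2.2 hb.1.2.symm hxy hab

/-- The neighbours of `x` that are neither `a` nor a neighbour of `a`. -/
noncomputable def outerNbrs (G : SimpleGraph V) (W : Finset V) (a x : V) : Finset V :=
  nbrs G W x \ insert a (nbrs G W a)

/-- For a set `A` of neighbours of `a`, the vertices in `A` together with their neighbours at
distance two from `a`. -/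
noncomputable def tree (G : SimpleGraph V) (W : Finset V) (a : V) (A : Finset V) : Finset V :=
  A ∪ A.biUnion (outerNbrs G W a)

theorem mem_outerNbrs {a x y : V} :
    y ∈ outerNbrs G W a x ↔ y ∈ W ∧ G.Adj x y ∧ y ≠ a ∧ ¬ G.Adj a y := by
  rw [outerNbrs, Finset.mem_sdiff, mem_nbrs, Finset.mem_insert, mem_nbrs]
  tauto

theorem card_nbrs_eq {a x : V} (ha : a ∈ W) (hx : G.Adj a x) :
    (nbrs G W x).card = (outerNbrs G W a x).card + 1 + (nbrs G W x ∩ nbrs G W a).card := by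
  have h1 : nbrs G W x ∩ insert a (nbrs G W a) = insert a (nbrs G W x ∩ nbrs G W a) := by
    rw [Finset.inter_insert_of_mem (mem_nbrs.2 ⟨ha, hx.symm⟩)]
  have h2 : a ∉ nbrs G W x ∩ nbrs G W a := fun h =>
    G.loopless.irrefl a (mem_nbrs.1 (Finset.mem_inter.1 h).2).2
  have h3 := Finset.card_sdiff_add_card_inter (nbrs G W x) (insert a (nbrs G W a))
  rw [h1, Finset.card_insert_of_notMem h2] at h3
  rw [outerNbrs]
  omega

theorem card_tree (hG : NoShortCycle G) {a : V} {A : Finset V} (hA : A ⊆ nbrs G W a) :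
    (tree G W a A).card = A.card + ∑ x ∈ A, (outerNbrs G W a x).card := by
  rw [tree, Finset.card_union_of_disjoint, Finset.card_biUnion]
  · intro x hx y hy hxy
    refine Finset.disjoint_left.2 fun z hz hz' => ?_
    obtain ⟨-, hxz, hza, -⟩ := mem_outerNbrs.1 hz
    obtain ⟨-, hyz, -, -⟩ := mem_outerNbrs.1 hz'
    exact hG.four a x z y (mem_nbrs.1 (hA hx)).2 hxz hyz.symm (mem_nbrs.1 (hA hy)).2.symm
      hza.symm hxy
  · refine Finset.disjoint_left.2 fun z hz hz' => ?_
    obtain ⟨x, -, hx⟩ := Finset.mem_biUnion.1 hz'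
    exact (mem_outerNbrs.1 hx).2.2.2 (mem_nbrs.1 (hA hz)).2

/-- The assumption `ht` excludes edges for which the closed neighbourhoods of the ends cover fewer
than `t` vertices. Neighbours of `a` that are adjacent to each other are counted in pairs. -/
theorem le_two_mul_card_tree (hG : NoShortCycle G) {t : ℕ} (ht7 : t ≤ 7)
    (hdeg : ∀ v ∈ W, 3 ≤ (nbrs G W v).card)
    (ht : ∀ u ∈ W, ∀ v ∈ W, G.Adj u v → t ≤ (nbrs G W u ∪ nbrs G W v).card)
    {a : V} (ha : a ∈ W) {A : Finset V} (hA : A ⊆ nbrs G W a)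
    (hcl : ∀ x ∈ A, nbrs G W x ∩ nbrs G W a ⊆ A) :
    (t - 1) * A.card ≤ 2 * (tree G W a A).card := by
  set σ : V → V := fun x =>
    if h : (nbrs G W x ∩ nbrs G W a).Nonempty then h.choose else x with hσ
  have hne : ∀ x ∈ A, x ≠ a := fun x hx h =>
    G.loopless.irrefl a (h ▸ (mem_nbrs.1 (hA hx)).2)
  have hσ1 : ∀ x, (nbrs G W x ∩ nbrs G W a).Nonempty → σ x ∈ nbrs G W x ∩ nbrs G W a := by
    intro x h
    rw [hσ]
    simp only [h, dif_pos]
    exact h.choose_spec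
  have hσ0 : ∀ x, ¬ (nbrs G W x ∩ nbrs G W a).Nonempty → σ x = x := by
    intro x h
    rw [hσ]
    simp only [h, dif_neg, not_false_eq_true]
  have hσA : ∀ x ∈ A, σ x ∈ A := by
    intro x hx
    by_cases h : (nbrs G W x ∩ nbrs G W a).Nonempty
    · exact hcl x hx (hσ1 x h)
    · rwa [hσ0 x h]
  have hback : ∀ x ∈ A, (nbrs G W x ∩ nbrs G W a).Nonempty →
      x ∈ nbrs G W (σ x) ∩ nbrs G W a := by
    intro x hx h
    obtain ⟨h1, h2⟩ := Finset.mem_inter.1 (hσ1 x h)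
    exact Finset.mem_inter.2 ⟨mem_nbrs.2 ⟨(mem_nbrs.1 (hA hx)).1, (mem_nbrs.1 h1).2.symm⟩, hA hx⟩
  have hσσ : ∀ x ∈ A, σ (σ x) = x := by
    intro x hx
    by_cases h : (nbrs G W x ∩ nbrs G W a).Nonempty
    · have h1 := hback x hx h
      exact Finset.card_le_one.1 (card_nbrs_inter_le_one hG (hne _ (hσA x hx))) _
        (hσ1 (σ x) ⟨x, h1⟩) _ h1
    · rw [hσ0 x h, hσ0 x h]
  have hpair : ∀ x ∈ A, t - 3 ≤ (outerNbrs G W a x).card + (outerNbrs G W a (σ x)).card := by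
    intro x hx
    obtain ⟨hxW, hax⟩ := mem_nbrs.1 (hA hx)
    obtain ⟨hyW, hay⟩ := mem_nbrs.1 (hA (hσA x hx))
    have hdx := card_nbrs_eq ha hax
    have hdy := card_nbrs_eq ha hay
    have h3x := hdeg x hxW
    by_cases h : (nbrs G W x ∩ nbrs G W a).Nonempty
    · have hxy : G.Adj x (σ x) := (mem_nbrs.1 (Finset.mem_inter.1 (hσ1 x h)).1).2
      have hs := ht x hxW (σ x) hyW hxy
      have hu := Finset.card_union_add_card_inter (nbrs G W x) (nbrs G W (σ x))
      have h1 : 1 ≤ (nbrs G W x ∩ nbrs G W (σ x)).card := Finset.card_pos.2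
        ⟨a, Finset.mem_inter.2 ⟨mem_nbrs.2 ⟨ha, hax.symm⟩, mem_nbrs.2 ⟨ha, hay.symm⟩⟩⟩
      have h2 := card_nbrs_inter_le_one (W := W) hG (hne x hx)
      have h3 := card_nbrs_inter_le_one (W := W) hG (hne _ (hσA x hx))
      omega
    · have h0 : (nbrs G W x ∩ nbrs G W a).card = 0 := by
        rw [Finset.card_eq_zero]
        exact Finset.not_nonempty_iff_eq_empty.1 h
      rw [hσ0 x h]
      omega
  have hsum : ∑ x ∈ A, (outerNbrs G W a (σ x)).card = ∑ x ∈ A, (outerNbrs G W a x).card :=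
    Finset.sum_nbij' σ σ hσA hσA hσσ hσσ fun _ _ => rfl
  have htot : A.card * (t - 3) ≤
      ∑ x ∈ A, ((outerNbrs G W a x).card + (outerNbrs G W a (σ x)).card) :=
    Finset.card_nsmul_le_sum A _ _ hpair
  rw [Finset.sum_add_distrib, hsum] at htot
  have h4 : (t - 1) * A.card ≤ (t - 3) * A.card + 2 * A.card := by
    rw [← add_mul]
    exact Nat.mul_le_mul_right _ (by omega)
  rw [card_tree hG hA, mul_add]
  rw [mul_comm] at htot
  omega

theorem le_card_tree (hG : NoShortCycle G) {t : ℕ}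
    (ht : ∀ u ∈ W, ∀ v ∈ W, G.Adj u v → t ≤ (nbrs G W u ∪ nbrs G W v).card)
    {a : V} (ha : a ∈ W) (h3 : (nbrs G W a).card = 3) {A : Finset V} (hA : A ⊆ nbrs G W a) :
    (t - 3) * A.card ≤ (tree G W a A).card := by
  have hx : ∀ x ∈ A, t - 4 ≤ (outerNbrs G W a x).card := by
    intro x hx
    obtain ⟨hxW, hax⟩ := mem_nbrs.1 (hA hx)
    have hdx := card_nbrs_eq ha hax
    have hs := ht x hxW a ha hax.symm
    have hu := Finset.card_union_add_card_inter (nbrs G W x) (nbrs G W a)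
    omega
  have hsum := Finset.card_nsmul_le_sum A _ _ hx
  have h4 : (t - 3) * A.card ≤ (t - 4) * A.card + A.card := by
    rw [← add_one_mul]
    exact Nat.mul_le_mul_right _ (by omega)
  rw [card_tree hG hA]
  rw [smul_eq_mul, mul_comm] at hsum
  omega

theorem disjoint_tree (hG : NoShortCycle G) {a b : V} (hab : G.Adj a b) {A B : Finset V}
    (hA : A ⊆ nbrs G W a) (hB : B ⊆ nbrs G W b) (hbA : b ∉ A) (haB : a ∉ B)
    (hAB : Disjoint A B) : Disjoint (tree G W a A) (tree G W b B) := by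
  have hne : ∀ x ∈ A, ∀ y ∈ B, x ≠ y := fun x hx y hy h =>
    Finset.disjoint_left.1 hAB hx (h ▸ hy)
  have h4 : ∀ x ∈ A, ∀ y ∈ B, ¬ G.Adj x y := by
    intro x hx y hy hxy
    exact hG.four a x y b (mem_nbrs.1 (hA hx)).2 hxy (mem_nbrs.1 (hB hy)).2.symm hab.symm
      (fun h => haB (h ▸ hy)) (fun h => hbA (h ▸ hx))
  refine Finset.disjoint_left.2 fun z hz hz' => ?_
  rcases Finset.mem_union.1 hz with hz | hz <;> rcases Finset.mem_union.1 hz' with hz' | hz'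
  · exact hne z hz z hz' rfl
  · obtain ⟨y, hy, hyz⟩ := Finset.mem_biUnion.1 hz'
    exact h4 z hz y hy (mem_outerNbrs.1 hyz).2.1.symm
  · obtain ⟨x, hx, hxz⟩ := Finset.mem_biUnion.1 hz
    exact h4 x hx z hz' (mem_outerNbrs.1 hxz).2.1
  · obtain ⟨x, hx, hxz⟩ := Finset.mem_biUnion.1 hz
    obtain ⟨y, hy, hyz⟩ := Finset.mem_biUnion.1 hz'
    obtain ⟨-, hxz, hza, hnza⟩ := mem_outerNbrs.1 hxz
    obtain ⟨-, hyz, hzb, -⟩ := mem_outerNbrs.1 hyz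
    exact hG.five a x z y b (mem_nbrs.1 (hA hx)).2 hxz hyz.symm (mem_nbrs.1 (hB hy)).2.symm
      hab.symm hza.symm (fun h => haB (h ▸ hy)) (hne x hx y hy) (fun h => hbA (h ▸ hx)) hzb

theorem notMem_tree {a r : V} {A : Finset V} (hA : A ⊆ nbrs G W a)
    (hr : r = a ∨ G.Adj a r ∧ r ∉ A) : r ∉ tree G W a A := by
  intro h
  rcases Finset.mem_union.1 h with hrA | h
  · rcases hr with rfl | hr
    · exact G.loopless.irrefl r (mem_nbrs.1 (hA hrA)).2
    · exact hr.2 hrA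
  · obtain ⟨x, -, hx⟩ := Finset.mem_biUnion.1 h
    obtain ⟨-, -, h1, h2⟩ := mem_outerNbrs.1 hx
    rcases hr with rfl | hr
    · exact h1 rfl
    · exact h2 hr.1

theorem tree_subset {a : V} {A : Finset V} (hA : A ⊆ nbrs G W a) : tree G W a A ⊆ W := by
  intro z hz
  rcases Finset.mem_union.1 hz with hz | hz
  · exact (mem_nbrs.1 (hA hz)).1
  · obtain ⟨x, -, hx⟩ := Finset.mem_biUnion.1 hz
    exact (mem_outerNbrs.1 hx).1

/-- If all degrees are at least three and the closed neighbourhoods of any two adjacent vertices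
cover at least `t` vertices, then the trees that grow from a triangle, or from an edge in a
triangle-free graph, have more than `12` vertices for `t = 6` and more than `18` for `t = 7`. -/
theorem lt_card_of_forall_le_card_union (hG : NoShortCycle G) {t : ℕ} (hne : W.Nonempty)
    (hdeg : ∀ v ∈ W, 3 ≤ (nbrs G W v).card)
    (ht : ∀ u ∈ W, ∀ v ∈ W, G.Adj u v → t ≤ (nbrs G W u ∪ nbrs G W v).card) :
    (t = 6 → 12 < W.card) ∧ (t = 7 → 18 < W.card) := by
  by_cases ht7 : t ≤ 7
  swap
  · exact ⟨by omega, by omega⟩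
  have hpair : ∀ u ∈ W, ∀ v ∈ W, G.Adj u v → t + (nbrs G W u ∩ nbrs G W v).card ≤
      (nbrs G W u).card + (nbrs G W v).card := by
    intro u hu v hv huv
    have := ht u hu v hv huv
    have := Finset.card_union_add_card_inter (nbrs G W u) (nbrs G W v)
    omega
  by_cases htri : ∃ a ∈ W, ∃ b ∈ W, ∃ c ∈ W, G.Adj a b ∧ G.Adj b c ∧ G.Adj c a
  · obtain ⟨a, ha, b, hb, c, hc, hab, hbc, hca⟩ := htri
    -- The bounds for the tree that grows from one vertex of a triangle.
    have key : ∀ a ∈ W, ∀ b ∈ W, ∀ c ∈ W, G.Adj a b → G.Adj b c → G.Adj c a →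
        (t - 1) * ((nbrs G W a).card - 2) ≤ 2 * (tree G W a (nbrs G W a \ {b, c})).card ∧
        ((nbrs G W a).card = 3 → t - 3 ≤ (tree G W a (nbrs G W a \ {b, c})).card) ∧
        t + 1 ≤ (nbrs G W a).card + (nbrs G W b).card := by
      intro a ha b hb c hc hab hbc hca
      have hsub : ({b, c} : Finset V) ⊆ nbrs G W a := by
        intro x hx
        rw [Finset.mem_insert, Finset.mem_singleton] at hx
        rcases hx with rfl | rfl
        · exact mem_nbrs.2 ⟨hb, hab⟩
        · exact mem_nbrs.2 ⟨hc, hca.symm⟩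
      have hcard : (nbrs G W a \ {b, c}).card = (nbrs G W a).card - 2 := by
        rw [Finset.card_sdiff_of_subset hsub, Finset.card_pair hbc.ne]
      have hcl : ∀ x ∈ nbrs G W a \ {b, c}, nbrs G W x ∩ nbrs G W a ⊆ nbrs G W a \ {b, c} := by
        intro x hx y hy
        rw [Finset.mem_sdiff, Finset.mem_insert, Finset.mem_singleton, not_or, mem_nbrs] at hx
        rw [Finset.mem_inter, mem_nbrs] at hy
        rw [Finset.mem_sdiff, Finset.mem_insert, Finset.mem_singleton, not_or]
        refine ⟨hy.2, ?_, ?_⟩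
        · rintro rfl
          exact hG.four a x y c hx.1.2 hy.1.2 hbc hca hab.ne hx.2.2
        · rintro rfl
          exact hG.four a x y b hx.1.2 hy.1.2 hbc.symm hab.symm hca.ne.symm hx.2.1
      refine ⟨?_, fun h3 => ?_, ?_⟩
      · rw [← hcard]
        exact le_two_mul_card_tree hG ht7 hdeg ht ha Finset.sdiff_subset hcl
      · have := le_card_tree hG ht ha h3 (A := nbrs G W a \ {b, c}) Finset.sdiff_subset
        rwa [hcard, h3, Nat.mul_one] at this
      · have h1 : 1 ≤ (nbrs G W a ∩ nbrs G W b).card := Finset.card_pos.2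
          ⟨c, Finset.mem_inter.2 ⟨mem_nbrs.2 ⟨hc, hca.symm⟩, mem_nbrs.2 ⟨hc, hbc⟩⟩⟩
        have := hpair a ha b hb hab
        omega
    have hdisj : ∀ a b c : V, a ∈ W → b ∈ W → c ∈ W → G.Adj a b → G.Adj b c → G.Adj c a →
        Disjoint (tree G W a (nbrs G W a \ {b, c})) (tree G W b (nbrs G W b \ {c, a})) := by
      intro a b c ha hb hc hab hbc hca
      refine disjoint_tree hG hab Finset.sdiff_subset Finset.sdiff_subset (by simp) (by simp) ?_
      refine Finset.disjoint_left.2 fun x hx hx' => ?_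
      rw [Finset.mem_sdiff, Finset.mem_insert, Finset.mem_singleton, not_or, mem_nbrs] at hx hx'
      exact hG.four a x b c hx.1.2 hx'.1.2.symm hbc hca hab.ne hx.2.2
    set Ta := tree G W a (nbrs G W a \ {b, c}) with hTa
    set Tb := tree G W b (nbrs G W b \ {c, a}) with hTb
    set Tc := tree G W c (nbrs G W c \ {a, b}) with hTc
    have hsub : {a, b, c} ∪ (Ta ∪ (Tb ∪ Tc)) ⊆ W := by
      refine Finset.union_subset ?_ (Finset.union_subset (tree_subset Finset.sdiff_subset)
        (Finset.union_subset (tree_subset Finset.sdiff_subset)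
          (tree_subset Finset.sdiff_subset)))
      intro x hx
      rw [Finset.mem_insert, Finset.mem_insert, Finset.mem_singleton] at hx
      rcases hx with rfl | rfl | rfl <;> assumption
    have hroot : Disjoint {a, b, c} (Ta ∪ (Tb ∪ Tc)) := by
      refine Finset.disjoint_left.2 fun x hx => ?_
      rw [Finset.mem_insert, Finset.mem_insert, Finset.mem_singleton] at hx
      rw [Finset.mem_union, Finset.mem_union, not_or, not_or]
      refine ⟨notMem_tree Finset.sdiff_subset ?_, notMem_tree Finset.sdiff_subset ?_,
        notMem_tree Finset.sdiff_subset ?_⟩ <;> rcases hx with rfl | rfl | rfl <;>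
        simp [hab, hbc, hca, hab.symm, hbc.symm, hca.symm]
    have hcard := Finset.card_le_card hsub
    rw [Finset.card_union_of_disjoint hroot, Finset.card_union_of_disjoint,
      Finset.card_union_of_disjoint (hdisj b c a hb hc ha hbc hca hab),
      Finset.card_eq_three.2 ⟨a, b, c, hab.ne, hca.ne.symm, hbc.ne, rfl⟩] at hcard
    swap
    · refine Finset.disjoint_union_right.2 ⟨hdisj a b c ha hb hc hab hbc hca, ?_⟩
      exact (hdisj c a b hc ha hb hca hab hbc).symm
    obtain ⟨a1, a2, a3⟩ := key a ha b hb c hc hab hbc hca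
    obtain ⟨b1, b2, b3⟩ := key b hb c hc a ha hbc hca hab
    obtain ⟨c1, c2, c3⟩ := key c hc a ha b hb hca hab hbc
    rw [← hTa] at a1 a2
    rw [← hTb] at b1 b2
    rw [← hTc] at c1 c2
    rw [← hTb, ← hTc] at hcard
    have da := hdeg a ha
    have db := hdeg b hb
    have dc := hdeg c hc
    -- By `a3`, `b3` and `c3`, at most one vertex of the triangle has degree three.
    constructor <;> rintro rfl <;> omega
  · obtain ⟨u, hu⟩ := hne
    obtain ⟨v, hv⟩ : (nbrs G W u).Nonempty := Finset.card_pos.1 (by have := hdeg u hu; omega)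
    obtain ⟨hv, huv⟩ := mem_nbrs.1 hv
    have key : ∀ u ∈ W, ∀ v ∈ W, G.Adj u v →
        (t - 1) * ((nbrs G W u).card - 1) ≤ 2 * (tree G W u (nbrs G W u \ {v})).card ∧
        ((nbrs G W u).card = 3 → (t - 3) * 2 ≤ (tree G W u (nbrs G W u \ {v})).card) := by
      intro u hu v hv huv
      have hcard : (nbrs G W u \ {v}).card = (nbrs G W u).card - 1 := by
        rw [Finset.card_sdiff_of_subset (Finset.singleton_subset_iff.2 (mem_nbrs.2 ⟨hv, huv⟩)),
          Finset.card_singleton]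
      refine ⟨?_, fun h3 => ?_⟩
      · rw [← hcard]
        refine le_two_mul_card_tree hG ht7 hdeg ht hu Finset.sdiff_subset fun x hx y hy => ?_
        rw [Finset.mem_sdiff, mem_nbrs] at hx
        rw [Finset.mem_inter, mem_nbrs, mem_nbrs] at hy
        exact absurd ⟨u, hu, x, hx.1.1, y, hy.1.1, hx.1.2, hy.1.2, hy.2.2.symm⟩ htri
      · have := le_card_tree hG ht hu h3 (A := nbrs G W u \ {v}) Finset.sdiff_subset
        rwa [hcard, h3] at this
    have hdisj : Disjoint (tree G W u (nbrs G W u \ {v})) (tree G W v (nbrs G W v \ {u})) := by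
      refine disjoint_tree hG huv Finset.sdiff_subset Finset.sdiff_subset (by simp) (by simp) ?_
      refine Finset.disjoint_left.2 fun x hx hx' => ?_
      rw [Finset.mem_sdiff, mem_nbrs] at hx hx'
      exact htri ⟨u, hu, x, hx.1.1, v, hv, hx.1.2, hx'.1.2.symm, huv.symm⟩
    set Tu := tree G W u (nbrs G W u \ {v}) with hTu
    set Tv := tree G W v (nbrs G W v \ {u}) with hTv
    have hsub : {u, v} ∪ (Tu ∪ Tv) ⊆ W := by
      refine Finset.union_subset ?_ (Finset.union_subset (tree_subset Finset.sdiff_subset)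
        (tree_subset Finset.sdiff_subset))
      intro x hx
      rw [Finset.mem_insert, Finset.mem_singleton] at hx
      rcases hx with rfl | rfl <;> assumption
    have hroot : Disjoint {u, v} (Tu ∪ Tv) := by
      refine Finset.disjoint_left.2 fun x hx => ?_
      rw [Finset.mem_insert, Finset.mem_singleton] at hx
      rw [Finset.mem_union, not_or]
      refine ⟨notMem_tree Finset.sdiff_subset ?_, notMem_tree Finset.sdiff_subset ?_⟩ <;>
        rcases hx with rfl | rfl <;> simp [huv, huv.symm]
    have hcard := Finset.card_le_card hsub
    rw [Finset.card_union_of_disjoint hroot, Finset.card_union_of_disjoint hdisj,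
      Finset.card_pair huv.ne] at hcard
    obtain ⟨u1, u2⟩ := key u hu v hv huv
    obtain ⟨v1, v2⟩ := key v hv u hu huv.symm
    rw [← hTu] at u1 u2
    rw [← hTv] at v1 v2
    have du := hdeg u hu
    have dv := hdeg v hv
    have hp := hpair u hu v hv huv
    constructor <;> rintro rfl <;> omega

end Counting

namespace GraphCode

/-! ### Gluing the neighbourhood of a vertex or of an edge -/

/-- Every set of `n` vertices without a `j`-subset inducing a matching has a code in `L`. -/
def Covers {V : Type*} [DecidableEq V] (G : SimpleGraph V) (j n : ℕ) (L : List ℕ) : Prop :=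
  ∀ W : Finset V, W.card = n → NoSparse G W j → Represents G W n L

theorem Covers.of_allMemIso {V : Type*} [DecidableEq V] {G : SimpleGraph V} {j n : ℕ}
    {L L' : List ℕ} (h : Covers G j n L) (hn : n ≤ 32) (hL : allMemIso n L' L = true) :
    Covers G j n L' :=
  fun W hW hno => (h W hW hno).of_allMemIso hn hL

/-- If `L` is empty, then `n` vertices always contain `j` vertices inducing a matching. -/
theorem Covers.card_lt {V : Type*} [DecidableEq V] {G : SimpleGraph V} {j n : ℕ}
    (h : Covers G j n []) {W : Finset V} (hW : NoSparse G W j) : W.card < n := by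
  by_contra hc
  obtain ⟨W', hW', hcard⟩ := Finset.exists_subset_card_eq (not_lt.1 hc)
  obtain ⟨-, -, A, hA, -⟩ := h W' hcard (hW.mono hW')
  exact List.not_mem_nil hA

theorem covers_zero {V : Type*} [DecidableEq V] [Nonempty V] (G : SimpleGraph V) (j : ℕ) :
    Covers G j 0 [0] := by
  intro W hW _
  obtain rfl := Finset.card_eq_zero.1 hW
  refine ⟨fun _ => Classical.arbitrary V, by simp, 0, List.mem_singleton_self _, ?_, ?_⟩
  · intro i hi
    omega
  · intro i j _
    simp

theorem image_update_range {V : Type*} [DecidableEq V] (f : ℕ → V) (n : ℕ) (x : V) :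
    (Finset.range (n + 1)).image (Function.update f n x) =
      insert x ((Finset.range n).image f) := by
  rw [Finset.range_add_one, Finset.image_insert, Function.update_self]
  congr 1
  refine Finset.image_congr fun i hi => ?_
  have : i < n := by simpa using hi
  exact Function.update_of_ne (by omega) _ _

theorem ne_of_image_eq {V : Type*} [DecidableEq V] {f : ℕ → V} {n : ℕ} {H : Finset V}
    (hf : (Finset.range n).image f = H) {x : V} (hx : x ∉ H) : ∀ i < n, f i ≠ x := by
  rintro i hi rfl
  exact hx (hf ▸ Finset.mem_image_of_mem _ (Finset.mem_range.2 hi))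

theorem Covers.extensions {V : Type*} [DecidableEq V] {G : SimpleGraph V} (hG : NoShortCycle G)
    {j n : ℕ} {L : List ℕ} (h : Covers G j n L) (hn : n < 32) :
    Covers G j (n + 1) (extensions j n 0 0 L) := by
  intro W hW hno
  obtain ⟨x, hx⟩ : W.Nonempty := Finset.card_pos.1 (by omega)
  obtain ⟨f, hf, hL⟩ := h (W.erase x) (by rw [Finset.card_erase_of_mem hx]; omega)
    (hno.mono (Finset.erase_subset _ _))
  have hins : insert x ((Finset.range n).image f) = W := by rw [hf, Finset.insert_erase hx]
  refine ⟨Function.update f n x, by rw [image_update_range, hins],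
    exists_mem_extensions hG hL hn (ne_of_image_eq hf (Finset.notMem_erase _ _)) (by simp)
      fun _ => by rwa [hins]⟩

/-- Adds to the graphs in `L`, on `n` vertices, two adjacent vertices without other neighbours. -/
noncomputable def addEdge (n : ℕ) (L : List ℕ) : List ℕ :=
  List.rec [] (fun A _ ih => extend A (n + 1) (Nat.shiftLeft 1 n) :: ih) L

theorem mem_addEdge {n A : ℕ} {L : List ℕ} (hA : A ∈ L) :
    extend A (n + 1) (Nat.shiftLeft 1 n) ∈ addEdge n L := by
  induction L with
  | nil => simp at hA
  | cons B L ih =>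
    change _ ∈ extend B (n + 1) (Nat.shiftLeft 1 n) :: addEdge n L
    rcases List.mem_cons.1 hA with rfl | hA
    · exact List.mem_cons_self
    · exact List.mem_cons_of_mem _ (ih hA)

/-- A new vertex without neighbours does not change the code. -/
theorem isCode_isolated {V : Type*} [DecidableEq V] {G : SimpleGraph V} {f : ℕ → V} {n A : ℕ}
    (h : IsCode G f n A) (hn : n < 32) {x : V} (hx : ∀ i < n, f i ≠ x)
    (hadj : ∀ i < n, ¬ G.Adj x (f i)) : IsCode G (Function.update f n x) (n + 1) A := by
  have h1 := isCode_extend (S := 0) h hn hx fun i => by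
    simpa using hadj i
  have h2 : extend A n 0 = (A ||| 0 <<< (32 * n)) ||| 0 := rfl
  rwa [h2, Nat.zero_shiftLeft, Nat.or_zero, Nat.or_zero] at h1

/-- Adds to the graphs in `L`, on `n + k` vertices, a vertex whose neighbours among the vertices
`n` and `n + 1` are given by the two bits of `F`. -/
noncomputable def addNbr (j n k F : ℕ) (L : List ℕ) : List ℕ :=
  extensions j (n + k) (Nat.shiftLeft 3 n) (Nat.shiftLeft F n) L

/-- `L` contains a code of the graph induced on the set `X` of `n + k` vertices, for a numbering
in which `u` and `v` have the numbers `n` and `n + 1`. -/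
def EdgeStage {V : Type*} [DecidableEq V] (G : SimpleGraph V) (u v : V) (n k : ℕ) (L : List ℕ)
    (X : Finset V) : Prop :=
  ∃ f : ℕ → V, f n = u ∧ f (n + 1) = v ∧ (Finset.range (n + k)).image f = X ∧
    ∃ A ∈ L, IsCode G f (n + k) A

theorem EdgeStage.of_represents {V : Type*} [DecidableEq V] {G : SimpleGraph V} {u v : V} {n : ℕ}
    {L : List ℕ} {H : Finset V} (h : Represents G H n L) (hn : n + 1 < 32) (huv : G.Adj u v)
    (hu : u ∉ H) (hv : v ∉ H) (huH : ∀ x ∈ H, ¬ G.Adj u x) (hvH : ∀ x ∈ H, ¬ G.Adj v x) :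
    EdgeStage G u v n 2 (addEdge n L) (insert v (insert u H)) := by
  obtain ⟨f, hf, A, hA, hc⟩ := h
  have hmem : ∀ i < n, f i ∈ H := fun i hi =>
    hf ▸ Finset.mem_image_of_mem _ (Finset.mem_range.2 hi)
  have hup : ∀ i < n, Function.update f n u i = f i := fun i hi =>
    Function.update_of_ne (by omega) _ _
  have h1 := isCode_isolated hc (by omega) (ne_of_image_eq hf hu) fun i hi => huH _ (hmem i hi)
  have himg : (Finset.range (n + 1)).image (Function.update f n u) = insert u H := by
    rw [image_update_range, hf]
  refine ⟨Function.update (Function.update f n u) (n + 1) v, ?_, Function.update_self .., ?_, _,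
    mem_addEdge hA, isCode_extend h1 hn (ne_of_image_eq himg ?_) fun i => ?_⟩
  · rw [Function.update_of_ne (by omega), Function.update_self]
  · rw [image_update_range, himg]
  · rw [Finset.mem_insert, not_or]
    exact ⟨huv.ne.symm, hv⟩
  · rw [testBit_one_shiftLeft, decide_eq_true_eq]
    constructor
    · rintro rfl
      rw [Function.update_self]
      exact ⟨by omega, huv.symm⟩
    · rintro ⟨hi, hadj⟩
      rcases Nat.lt_succ_iff_lt_or_eq.1 hi with hi | rfl
      · rw [hup i hi] at hadj
        exact absurd hadj (hvH _ (hmem i hi))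
      · rfl

theorem EdgeStage.addNbr {V : Type*} [DecidableEq V] {G : SimpleGraph V} (hG : NoShortCycle G)
    {u v x : V} {j n k F : ℕ} {L : List ℕ} {W X : Finset V} (hX : EdgeStage G u v n k L X)
    (hk : 2 ≤ k) (hn : n + k < 32) (hno : j ≠ 0 → NoSparse G W j) (hXW : X ⊆ W) (hxW : x ∈ W)
    (hxX : x ∉ X) (hF : F < 4) (hxu : F.testBit 0 = true ↔ G.Adj x u)
    (hxv : F.testBit 1 = true ↔ G.Adj x v) :
    EdgeStage G u v n (k + 1) (addNbr j n k F L) (insert x X) := by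
  obtain ⟨f, hfu, hfv, hf, hL⟩ := hX
  refine ⟨Function.update f (n + k) x, ?_, ?_, ?_,
    exists_mem_extensions hG hL hn (ne_of_image_eq hf hxX) (fun i => ?_) fun hj =>
      (hno hj).mono ?_⟩
  · rw [Function.update_of_ne (by omega), hfu]
  · rw [Function.update_of_ne (by omega), hfv]
  · rw [← add_assoc, image_update_range, hf]
  · have h3 : ∀ i, Nat.testBit 3 i = true ↔ i < 2 := fun i => by
      have : (3 : ℕ) = 2 ^ 2 - 1 := rfl
      rw [this, Nat.testBit_two_pow_sub_one, decide_eq_true_eq]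
    have hF2 : ∀ i, F.testBit i = true → i < 2 := fun i hi => by
      by_contra hc
      rw [Nat.testBit_lt_two_pow (lt_of_lt_of_le hF
        (Nat.pow_le_pow_right (n := 2) (by omega) (not_lt.1 hc)))] at hi
      exact Bool.false_ne_true hi
    rw [shiftLeft_eq, shiftLeft_eq, Nat.testBit_shiftLeft, Nat.testBit_shiftLeft,
      Bool.and_eq_true, Bool.and_eq_true, decide_eq_true_eq, h3]
    by_cases hi : n ≤ i ∧ i < n + 2
    · obtain rfl | rfl : i = n ∨ i = n + 1 := by omega
      · rw [Nat.sub_self, hxu, hfu]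
        constructor
        · rintro ⟨-, h⟩
          exact ⟨by omega, ⟨le_rfl, by omega⟩, h⟩
        · rintro ⟨-, -, h⟩
          exact ⟨le_rfl, h⟩
      · rw [Nat.add_sub_cancel_left, hxv, hfv]
        constructor
        · rintro ⟨-, h⟩
          exact ⟨by omega, ⟨by omega, by omega⟩, h⟩
        · rintro ⟨-, -, h⟩
          exact ⟨by omega, h⟩
    · constructor
      · rintro ⟨h1, h2⟩
        have := hF2 _ h2
        omega
      · rintro ⟨-, ⟨h1, h2⟩, -⟩
        omega
  · rw [hf]
    exact Finset.insert_subset hxW hXW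

/-- Codes on `n + 2` vertices: adds to graphs on `n` vertices a vertex with one neighbour. -/
noncomputable def glueDegreeOne (j n : ℕ) (L : List ℕ) : List ℕ :=
  extensions j (n + 1) (Nat.shiftLeft 1 n) (Nat.shiftLeft 1 n) L

/-- Codes on `n + 3` vertices: adds to graphs on `n` vertices a vertex with two neighbours. -/
noncomputable def glueDegreeTwo (j n : ℕ) (L : List ℕ) : List ℕ :=
  extensions j (n + 2) (Nat.shiftLeft 1 n) (Nat.shiftLeft 1 n) (glueDegreeOne j n L)

/-- Codes on `n + 5` vertices: adds to graphs on `n` vertices an edge in a triangle, both ends of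
which have degree three. -/
noncomputable def glueTriangle (j n : ℕ) (L : List ℕ) : List ℕ :=
  addNbr j n 4 2 (addNbr j n 3 1 (addNbr 0 n 2 3 (addEdge n L)))

/-- Codes on `n + 6` vertices: adds to graphs on `n` vertices an edge in a triangle, the ends of
which have degrees three and four. -/
noncomputable def glueLargeTriangle (j n : ℕ) (L : List ℕ) : List ℕ :=
  addNbr j n 5 2 (glueTriangle j n L)

/-- Codes on `n + 6` vertices: adds to graphs on `n` vertices an edge in no triangle, both ends of
which have degree three. -/
noncomputable def glueEdge (j n : ℕ) (L : List ℕ) : List ℕ :=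
  addNbr j n 5 2 (addNbr j n 4 2 (addNbr j n 3 1 (addNbr 0 n 2 1 (addEdge n L))))

variable {V : Type*} [DecidableEq V] {G : SimpleGraph V} {W : Finset V}

theorem noSparse_sdiff_vertex {j : ℕ} (hno : NoSparse G W (j + 1)) {v : V} (hv : v ∈ W) :
    NoSparse G (W \ insert v (nbrs G W v)) j := by
  intro T hT hcard hm
  have hvT : v ∉ T := fun h =>
    (Finset.mem_sdiff.1 (hT h)).2 (Finset.mem_insert_self _ _)
  have hadj : ∀ x ∈ T, ¬ G.Adj v x := fun x hx h =>
    (Finset.mem_sdiff.1 (hT hx)).2 (Finset.mem_insert_of_mem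
      (mem_nbrs.2 ⟨(Finset.mem_sdiff.1 (hT hx)).1, h⟩))
  refine hno (insert v T) ?_ ?_ ?_
  · exact Finset.insert_subset hv fun x hx => (Finset.mem_sdiff.1 (hT hx)).1
  · rw [Finset.card_insert_of_notMem hvT, hcard]
  · intro x hx a ha b hb hxa hxb
    rw [Finset.mem_insert] at hx ha hb
    rcases hx with rfl | hx
    · rcases ha with rfl | ha
      · exact absurd hxa (G.loopless.irrefl _)
      · exact absurd hxa (hadj a ha)
    · rcases ha with rfl | ha
      · exact absurd hxa.symm (hadj x hx)
      rcases hb with rfl | hb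
      · exact absurd hxb.symm (hadj x hx)
      exact hm x hx a ha b hb hxa hxb

theorem noSparse_sdiff_edge {j : ℕ} (hno : NoSparse G W (j + 2)) {u v : V} (hu : u ∈ W)
    (hv : v ∈ W) (huv : G.Adj u v) : NoSparse G (W \ (nbrs G W u ∪ nbrs G W v)) j := by
  intro T hT hcard hm
  have hTW : ∀ x ∈ T, x ∈ W := fun x hx => (Finset.mem_sdiff.1 (hT hx)).1
  have huT : ∀ x ∈ T, ¬ G.Adj u x := fun x hx h =>
    (Finset.mem_sdiff.1 (hT hx)).2 (Finset.mem_union_left _ (mem_nbrs.2 ⟨hTW x hx, h⟩))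
  have hvT : ∀ x ∈ T, ¬ G.Adj v x := fun x hx h =>
    (Finset.mem_sdiff.1 (hT hx)).2 (Finset.mem_union_right _ (mem_nbrs.2 ⟨hTW x hx, h⟩))
  have hu' : u ∉ T := fun h => hvT u h huv.symm
  have hv' : v ∉ T := fun h => huT v h huv
  refine hno (insert u (insert v T)) ?_ ?_ ?_
  · exact Finset.insert_subset hu (Finset.insert_subset hv hTW)
  · rw [Finset.card_insert_of_notMem, Finset.card_insert_of_notMem hv', hcard]
    rw [Finset.mem_insert, not_or]
    exact ⟨huv.ne, hu'⟩
  · have key : ∀ x ∈ insert u (insert v T), ∀ a ∈ insert u (insert v T), G.Adj x a →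
        (x = u ∧ a = v) ∨ (x = v ∧ a = u) ∨ (x ∈ T ∧ a ∈ T) := by
      intro x hx a ha hxa
      rw [Finset.mem_insert, Finset.mem_insert] at hx ha
      rcases hx with rfl | rfl | hx <;> rcases ha with rfl | rfl | ha
      · exact absurd hxa (G.loopless.irrefl _)
      · exact Or.inl ⟨rfl, rfl⟩
      · exact absurd hxa (huT a ha)
      · exact Or.inr (Or.inl ⟨rfl, rfl⟩)
      · exact absurd hxa (G.loopless.irrefl _)
      · exact absurd hxa (hvT a ha)
      · exact absurd hxa.symm (huT x hx)
      · exact absurd hxa.symm (hvT x hx)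
      · exact Or.inr (Or.inr ⟨hx, ha⟩)
    intro x hx a ha b hb hxa hxb
    rcases key x hx a ha hxa with ⟨rfl, rfl⟩ | ⟨rfl, rfl⟩ | ⟨hx', ha'⟩ <;>
      rcases key x hx b hb hxb with ⟨h, rfl⟩ | ⟨h, rfl⟩ | ⟨hx'', hb'⟩
    · rfl
    · exact absurd h huv.ne
    · exact absurd hx'' hu'
    · exact absurd h huv.ne.symm
    · rfl
    · exact absurd hx'' hv'
    · exact absurd (h ▸ hx') hu'
    · exact absurd (h ▸ hx') hv'
    · exact hm x hx' a ha' b hb' hxa hxb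

/-- A set with a vertex of degree at most two is obtained by gluing. -/
theorem represents_of_card_nbrs_le_two (hG : NoShortCycle G) {j m : ℕ} {L₁ L₂ : List ℕ}
    (hm : m + 3 ≤ 32) (hb : ∀ W : Finset V, NoSparse G W j → W.card ≤ m + 1)
    (h₁ : Covers G j (m + 1) L₁) (h₂ : Covers G j m L₂) (hW : W.card = m + 3)
    (hno : NoSparse G W (j + 1)) {v : V} (hv : v ∈ W) (hd : (nbrs G W v).card ≤ 2) :
    Represents G W (m + 3) (glueDegreeOne (j + 1) (m + 1) L₁) ∨
      Represents G W (m + 3) (glueDegreeTwo (j + 1) m L₂) := by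
  have hvn : v ∉ nbrs G W v := fun h => G.loopless.irrefl v (mem_nbrs.1 h).2
  have hsub : insert v (nbrs G W v) ⊆ W :=
    Finset.insert_subset hv fun x hx => (mem_nbrs.1 hx).1
  set H := W \ insert v (nbrs G W v) with hH
  have hnoH : NoSparse G H j := noSparse_sdiff_vertex hno hv
  have hHcard : H.card + ((nbrs G W v).card + 1) = m + 3 := by
    rw [← hW, hH, ← Finset.card_insert_of_notMem hvn, Finset.card_sdiff_add_card_eq_card hsub]
  have hvH : v ∉ H := fun h => (Finset.mem_sdiff.1 h).2 (Finset.mem_insert_self _ _)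
  have hnH : ∀ x ∈ nbrs G W v, x ∉ H := fun x hx h =>
    (Finset.mem_sdiff.1 h).2 (Finset.mem_insert_of_mem hx)
  have hadjH : ∀ x ∈ H, ¬ G.Adj v x := fun x hx h => hnH x
    (mem_nbrs.2 ⟨(Finset.mem_sdiff.1 hx).1, h⟩) hx
  have hWeq : W = insert v (nbrs G W v) ∪ H := by
    rw [hH, Finset.union_sdiff_of_subset hsub]
  -- After `v`, the vertex with the number `n`, a neighbour `x` of `v` is added.
  have step : ∀ {f : ℕ → V} {n k : ℕ} {L : List ℕ} {x : V} {X : Finset V},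
      1 ≤ k → n + k < 32 → (∃ A ∈ L, IsCode G f (n + k) A) → f n = v →
      (Finset.range (n + k)).image f = X → x ∈ nbrs G W v → x ∉ X → X ⊆ W →
      ∃ f' : ℕ → V, f' n = v ∧ (Finset.range (n + (k + 1))).image f' = insert x X ∧
        ∃ A ∈ extensions (j + 1) (n + k) (Nat.shiftLeft 1 n) (Nat.shiftLeft 1 n) L,
          IsCode G f' (n + (k + 1)) A := by
    intro f n k L x X hk hn hL hfn hX hx hxX hXW
    refine ⟨Function.update f (n + k) x, ?_, ?_,
      exists_mem_extensions hG hL hn (ne_of_image_eq hX hxX) (fun i => ?_) fun _ => hno.mono ?_⟩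
    · rw [Function.update_of_ne (by omega), hfn]
    · rw [← add_assoc, image_update_range, hX]
    · rw [testBit_one_shiftLeft, decide_eq_true_eq]
      constructor
      · rintro rfl
        rw [hfn]
        exact ⟨by omega, rfl, (mem_nbrs.1 hx).2.symm⟩
      · exact fun h => h.2.1
    · rw [hX]
      exact Finset.insert_subset (mem_nbrs.1 hx).1 hXW
  have hvHW : insert v H ⊆ W := Finset.insert_subset hv Finset.sdiff_subset
  -- The code of `H` with the vertex `v` added to it.
  have start : ∀ {n : ℕ} {L : List ℕ}, n < 32 → Represents G H n L → ∃ f : ℕ → V, f n = v ∧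
      (Finset.range (n + 1)).image f = insert v H ∧ ∃ A ∈ L, IsCode G f (n + 1) A := by
    rintro n L hn ⟨f, hf, A, hA, hc⟩
    refine ⟨Function.update f n v, Function.update_self .., by rw [image_update_range, hf], A, hA,
      isCode_isolated hc hn (ne_of_image_eq hf hvH) fun i hi => hadjH _ ?_⟩
    exact hf ▸ Finset.mem_image_of_mem _ (Finset.mem_range.2 hi)
  have hbH := hb H hnoH
  obtain hd1 | hd2 : (nbrs G W v).card = 1 ∨ (nbrs G W v).card = 2 := by omega
  · left
    obtain ⟨x, hx⟩ := Finset.card_eq_one.1 hd1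
    have hxm : x ∈ nbrs G W v := hx ▸ Finset.mem_singleton_self x
    obtain ⟨f, hfv, hf, hL⟩ := start (by omega) (h₁ H (by omega) hnoH)
    obtain ⟨f', -, hf', hL'⟩ := step le_rfl (by omega) hL hfv hf hxm (by
      rw [Finset.mem_insert, not_or]
      exact ⟨fun h => hvn (h ▸ hxm), hnH x hxm⟩) hvHW
    refine ⟨f', hf'.trans ?_, hL'⟩
    rw [hWeq, hx]
    ext y
    simp only [Finset.mem_insert, Finset.mem_union, Finset.mem_singleton]
    tauto
  · right
    obtain ⟨x, y, hxy, hx⟩ := Finset.card_eq_two.1 hd2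
    have hxm : x ∈ nbrs G W v := by rw [hx]; simp
    have hym : y ∈ nbrs G W v := by rw [hx]; simp
    obtain ⟨f, hfv, hf, hL⟩ := start (by omega) (h₂ H (by omega) hnoH)
    have hxX : x ∉ insert v H := by
      rw [Finset.mem_insert, not_or]
      exact ⟨fun h => hvn (h ▸ hxm), hnH x hxm⟩
    obtain ⟨f', hfv', hf', hL'⟩ := step le_rfl (by omega) hL hfv hf hxm hxX hvHW
    obtain ⟨f'', -, hf'', hL''⟩ := step (by omega) (by omega) hL' hfv' hf' hym (by
      rw [Finset.mem_insert, Finset.mem_insert, not_or, not_or]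
      exact ⟨hxy.symm, fun h => hvn (h ▸ hym), hnH y hym⟩)
      (Finset.insert_subset (mem_nbrs.1 hxm).1 hvHW)
    refine ⟨f'', hf''.trans ?_, hL''⟩
    rw [hWeq, hx]
    ext z
    simp only [Finset.mem_insert, Finset.mem_union, Finset.mem_singleton]
    tauto

theorem EdgeStage.represents {u v : V} {n k : ℕ} {L : List ℕ} {X : Finset V}
    (h : EdgeStage G u v n k L X) (hX : X = W) : Represents G W (n + k) L := by
  obtain ⟨f, -, -, hf, hL⟩ := h
  exact ⟨f, hf.trans hX, hL⟩

/-- A set with an edge `u v` in a triangle is obtained by gluing if `u` has degree three and `v` has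
degree three or four. -/
theorem represents_of_triangle (hG : NoShortCycle G) {j m : ℕ} {L : List ℕ} (hm : m + 6 ≤ 32)
    (hno : NoSparse G W (j + 2)) {u v w x : V} {Y : Finset V} (hu : u ∈ W) (hv : v ∈ W)
    (huv : G.Adj u v) (hNu : nbrs G W u = {v, w, x}) (hNv : nbrs G W v = insert u (insert w Y))
    (hvw : v ≠ w) (hvx : v ≠ x) (hwx : w ≠ x) (hY : ∀ y ∈ Y, y ≠ u ∧ y ≠ w)
    (hL : Represents G (W \ (nbrs G W u ∪ nbrs G W v)) m L) :
    (Y.card = 1 → Represents G W (m + 5) (glueTriangle (j + 2) m L)) ∧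
      (Y.card = 2 → Represents G W (m + 6) (glueLargeTriangle (j + 2) m L)) := by
  set H := W \ (nbrs G W u ∪ nbrs G W v) with hH
  have hmem : ∀ z, z ∈ H → z ∈ W ∧ z ∉ nbrs G W u ∧ z ∉ nbrs G W v := by
    intro z hz
    rw [hH, Finset.mem_sdiff, Finset.mem_union, not_or] at hz
    exact hz
  have hWeq : ∀ z, z ∈ W ↔ z ∈ H ∨ z ∈ nbrs G W u ∨ z ∈ nbrs G W v := by
    intro z
    rw [hH, Finset.mem_sdiff, Finset.mem_union]
    have : z ∈ nbrs G W u → z ∈ W := fun h => (mem_nbrs.1 h).1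
    have : z ∈ nbrs G W v → z ∈ W := fun h => (mem_nbrs.1 h).1
    tauto
  have huN : u ∈ nbrs G W v := mem_nbrs.2 ⟨hu, huv.symm⟩
  have hvN : v ∈ nbrs G W u := mem_nbrs.2 ⟨hv, huv⟩
  have hwu : w ∈ nbrs G W u := by rw [hNu]; simp
  have hwv : w ∈ nbrs G W v := by rw [hNv]; simp
  have hxu : x ∈ nbrs G W u := by rw [hNu]; simp
  have hYv : ∀ y ∈ Y, y ∈ nbrs G W v := fun y hy => by rw [hNv]; simp [hy]
  have hun : u ∉ nbrs G W u := fun h => G.loopless.irrefl u (mem_nbrs.1 h).2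
  have hvn : v ∉ nbrs G W v := fun h => G.loopless.irrefl v (mem_nbrs.1 h).2
  -- Two common neighbours of `u` and `v` would give a cycle of length four.
  have hcommon : ∀ z, z ∈ nbrs G W u → z ∈ nbrs G W v → z = w := fun z hz hz' =>
    Finset.card_le_one.1 (card_nbrs_inter_le_one (W := W) hG huv.ne) z
      (Finset.mem_inter.2 ⟨hz, hz'⟩) w (Finset.mem_inter.2 ⟨hwu, hwv⟩)
  have hxv : ¬ G.Adj x v := fun h => hwx
    (hcommon x hxu (mem_nbrs.2 ⟨(mem_nbrs.1 hxu).1, h.symm⟩)).symm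
  have hYu : ∀ y ∈ Y, ¬ G.Adj y u := fun y hy h => (hY y hy).2
    (hcommon y (mem_nbrs.2 ⟨(mem_nbrs.1 (hYv y hy)).1, h.symm⟩) (hYv y hy))
  have hYx : ∀ y ∈ Y, y ≠ x := fun y hy h => hYu y hy (h ▸ (mem_nbrs.1 hxu).2.symm)
  have hYvne : ∀ y ∈ Y, y ≠ v := fun y hy h => hvn (h ▸ hYv y hy)
  have huW : ({v, u} : Finset V) ⊆ W := by
    intro z hz
    rw [Finset.mem_insert, Finset.mem_singleton] at hz
    rcases hz with rfl | rfl <;> assumption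
  have s0 := EdgeStage.of_represents hL (by omega) huv (fun h => (hmem u h).2.2 huN)
    (fun h => (hmem v h).2.1 hvN)
    (fun z hz h => (hmem z hz).2.1 (mem_nbrs.2 ⟨(hmem z hz).1, h⟩))
    (fun z hz h => (hmem z hz).2.2 (mem_nbrs.2 ⟨(hmem z hz).1, h⟩))
  have w0 : insert v (insert u H) ⊆ W :=
    Finset.insert_subset hv (Finset.insert_subset hu Finset.sdiff_subset)
  have s1 := s0.addNbr hG (j := 0) (F := 3) (W := W) (x := w) le_rfl (by omega)
    (fun h => absurd rfl h) w0 (mem_nbrs.1 hwu).1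
    (by
      simp only [Finset.mem_insert, not_or]
      exact ⟨hvw.symm, fun h => hun (h ▸ hwu), fun h => (hmem w h).2.1 hwu⟩)
    (by omega) (iff_of_true rfl (mem_nbrs.1 hwu).2.symm)
    (iff_of_true rfl (mem_nbrs.1 hwv).2.symm)
  have w1 := Finset.insert_subset (mem_nbrs.1 hwu).1 w0
  have s2 := s1.addNbr hG (j := j + 2) (F := 1) (W := W) (x := x) (by omega) (by omega)
    (fun _ => hno) w1 (mem_nbrs.1 hxu).1
    (by
      simp only [Finset.mem_insert, not_or]
      exact ⟨hwx.symm, hvx.symm, fun h => hun (h ▸ hxu), fun h => (hmem x h).2.1 hxu⟩)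
    (by omega) (iff_of_true rfl (mem_nbrs.1 hxu).2.symm) (iff_of_false (by decide) hxv)
  have w2 := Finset.insert_subset (mem_nbrs.1 hxu).1 w1
  have hyX : ∀ y ∈ Y, y ∉ insert x (insert w (insert v (insert u H))) := by
    intro y hy
    simp only [Finset.mem_insert, not_or]
    exact ⟨hYx y hy, (hY y hy).2, hYvne y hy, (hY y hy).1, fun h => (hmem y h).2.2 (hYv y hy)⟩
  have s3 : ∀ y ∈ Y, EdgeStage G u v m 5 (glueTriangle (j + 2) m L)
      (insert y (insert x (insert w (insert v (insert u H))))) := fun y hy =>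
    s2.addNbr hG (j := j + 2) (F := 2) (W := W) (by omega) (by omega) (fun _ => hno) w2
      (mem_nbrs.1 (hYv y hy)).1 (hyX y hy) (by omega) (iff_of_false (by decide) (hYu y hy))
      (iff_of_true rfl (mem_nbrs.1 (hYv y hy)).2.symm)
  constructor
  · intro h1
    obtain ⟨y, rfl⟩ := Finset.card_eq_one.1 h1
    refine (s3 y (by simp)).represents ?_
    ext z
    rw [hWeq, hNu, hNv]
    simp only [Finset.mem_insert, Finset.mem_singleton]
    tauto
  · intro h2
    obtain ⟨y, y', hyy, rfl⟩ := Finset.card_eq_two.1 h2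
    have hy : y ∈ ({y, y'} : Finset V) := by simp
    have hy' : y' ∈ ({y, y'} : Finset V) := by simp
    have s4 := (s3 y hy).addNbr hG (j := j + 2) (F := 2) (W := W) (x := y') (by omega) (by omega)
      (fun _ => hno) (Finset.insert_subset (mem_nbrs.1 (hYv y hy)).1 w2)
      (mem_nbrs.1 (hYv y' hy')).1
      (by
        rw [Finset.mem_insert, not_or]
        exact ⟨hyy.symm, hyX y' hy'⟩)
      (by omega) (iff_of_false (by decide) (hYu y' hy'))
      (iff_of_true rfl (mem_nbrs.1 (hYv y' hy')).2.symm)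
    refine s4.represents ?_
    ext z
    rw [hWeq, hNu, hNv]
    simp only [Finset.mem_insert, Finset.mem_singleton]
    tauto

/-- A set with an edge in no triangle, with ends of degree three, is obtained by gluing. -/
theorem represents_of_edge (hG : NoShortCycle G) {j m : ℕ} {L : List ℕ} (hm : m + 6 ≤ 32)
    (hno : NoSparse G W (j + 2)) {u v : V} (hu : u ∈ W) (hv : v ∈ W)
    (huv : G.Adj u v) (hdu : (nbrs G W u).card = 3) (hdv : (nbrs G W v).card = 3)
    (hdisj : Disjoint (nbrs G W u) (nbrs G W v))
    (hL : Represents G (W \ (nbrs G W u ∪ nbrs G W v)) m L) :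
    Represents G W (m + 6) (glueEdge (j + 2) m L) := by
  set H := W \ (nbrs G W u ∪ nbrs G W v) with hH
  have hmem : ∀ z, z ∈ H → z ∈ W ∧ z ∉ nbrs G W u ∧ z ∉ nbrs G W v := by
    intro z hz
    rw [hH, Finset.mem_sdiff, Finset.mem_union, not_or] at hz
    exact hz
  have hWeq : ∀ z, z ∈ W ↔ z ∈ H ∨ z ∈ nbrs G W u ∨ z ∈ nbrs G W v := by
    intro z
    rw [hH, Finset.mem_sdiff, Finset.mem_union]
    have : z ∈ nbrs G W u → z ∈ W := fun h => (mem_nbrs.1 h).1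
    have : z ∈ nbrs G W v → z ∈ W := fun h => (mem_nbrs.1 h).1
    tauto
  have huN : u ∈ nbrs G W v := mem_nbrs.2 ⟨hu, huv.symm⟩
  have hvN : v ∈ nbrs G W u := mem_nbrs.2 ⟨hv, huv⟩
  obtain ⟨x, x', hxx, hX⟩ := Finset.card_eq_two.1
    (show ((nbrs G W u).erase v).card = 2 by rw [Finset.card_erase_of_mem hvN, hdu])
  obtain ⟨y, y', hyy, hY⟩ := Finset.card_eq_two.1
    (show ((nbrs G W v).erase u).card = 2 by rw [Finset.card_erase_of_mem huN, hdv])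
  have hNu : nbrs G W u = insert v {x, x'} := by rw [← hX, Finset.insert_erase hvN]
  have hNv : nbrs G W v = insert u {y, y'} := by rw [← hY, Finset.insert_erase huN]
  have hXm : ∀ z ∈ ({x, x'} : Finset V), z ≠ v ∧ z ∈ nbrs G W u ∧ z ∉ nbrs G W v ∧ z ≠ u := by
    intro z hz
    rw [← hX, Finset.mem_erase] at hz
    exact ⟨hz.1, hz.2, Finset.disjoint_left.1 hdisj hz.2,
      fun h => G.loopless.irrefl u (mem_nbrs.1 (h ▸ hz.2)).2⟩
  have hYm : ∀ z ∈ ({y, y'} : Finset V), z ≠ u ∧ z ∈ nbrs G W v ∧ z ∉ nbrs G W u ∧ z ≠ v := by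
    intro z hz
    rw [← hY, Finset.mem_erase] at hz
    exact ⟨hz.1, hz.2, Finset.disjoint_right.1 hdisj hz.2,
      fun h => G.loopless.irrefl v (mem_nbrs.1 (h ▸ hz.2)).2⟩
  have s0 := EdgeStage.of_represents hL (by omega) huv (fun h => (hmem u h).2.2 huN)
    (fun h => (hmem v h).2.1 hvN)
    (fun z hz h => (hmem z hz).2.1 (mem_nbrs.2 ⟨(hmem z hz).1, h⟩))
    (fun z hz h => (hmem z hz).2.2 (mem_nbrs.2 ⟨(hmem z hz).1, h⟩))
  have w0 : insert v (insert u H) ⊆ W :=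
    Finset.insert_subset hv (Finset.insert_subset hu Finset.sdiff_subset)
  have addX : ∀ {i k : ℕ} {L : List ℕ} {X : Finset V}, (i ≠ 0 → NoSparse G W i) → 2 ≤ k → k < 6 →
      EdgeStage G u v m k L X → X ⊆ W → ∀ z ∈ ({x, x'} : Finset V), z ∉ X →
      EdgeStage G u v m (k + 1) (addNbr i m k 1 L) (insert z X) ∧ insert z X ⊆ W := by
    intro i k L X hi hk hk6 hs hXW z hz hzX
    obtain ⟨-, h2, h3, -⟩ := hXm z hz
    refine ⟨hs.addNbr hG hk (by omega) hi hXW (mem_nbrs.1 h2).1 hzX (by omega)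
      (iff_of_true rfl (mem_nbrs.1 h2).2.symm) ?_, Finset.insert_subset (mem_nbrs.1 h2).1 hXW⟩
    exact iff_of_false (by decide) fun h : G.Adj z v => h3 (mem_nbrs.2 ⟨(mem_nbrs.1 h2).1, h.symm⟩)
  have addY : ∀ {i k : ℕ} {L : List ℕ} {X : Finset V}, (i ≠ 0 → NoSparse G W i) → 2 ≤ k → k < 6 →
      EdgeStage G u v m k L X → X ⊆ W → ∀ z ∈ ({y, y'} : Finset V), z ∉ X →
      EdgeStage G u v m (k + 1) (addNbr i m k 2 L) (insert z X) ∧ insert z X ⊆ W := by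
    intro i k L X hi hk hk6 hs hXW z hz hzX
    obtain ⟨-, h2, h3, -⟩ := hYm z hz
    refine ⟨hs.addNbr hG hk (by omega) hi hXW (mem_nbrs.1 h2).1 hzX (by omega)
      ?_ (iff_of_true rfl (mem_nbrs.1 h2).2.symm), Finset.insert_subset (mem_nbrs.1 h2).1 hXW⟩
    exact iff_of_false (by decide) fun h : G.Adj z u => h3 (mem_nbrs.2 ⟨(mem_nbrs.1 h2).1, h.symm⟩)
  have hx := hXm x (by simp)
  have hx' := hXm x' (by simp)
  have hy := hYm y (by simp)
  have hy' := hYm y' (by simp)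
  obtain ⟨s1, w1⟩ := addX (i := 0) (fun h => absurd rfl h) le_rfl (by omega) s0 w0 x (by simp)
    (by
      simp only [Finset.mem_insert, not_or]
      exact ⟨hx.1, hx.2.2.2, fun h => (hmem x h).2.1 hx.2.1⟩)
  obtain ⟨s2, w2⟩ := addX (i := j + 2) (fun _ => hno) (by omega) (by omega) s1 w1 x' (by simp)
    (by
      simp only [Finset.mem_insert, not_or]
      exact ⟨hxx.symm, hx'.1, hx'.2.2.2, fun h => (hmem x' h).2.1 hx'.2.1⟩)
  obtain ⟨s3, w3⟩ := addY (i := j + 2) (fun _ => hno) (by omega) (by omega) s2 w2 y (by simp)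
    (by
      simp only [Finset.mem_insert, not_or]
      exact ⟨fun h => hy.2.2.1 (h ▸ hx'.2.1), fun h => hy.2.2.1 (h ▸ hx.2.1), hy.2.2.2, hy.1,
        fun h => (hmem y h).2.2 hy.2.1⟩)
  obtain ⟨s4, -⟩ := addY (i := j + 2) (fun _ => hno) (by omega) (by omega) s3 w3 y' (by simp)
    (by
      simp only [Finset.mem_insert, not_or]
      exact ⟨hyy.symm, fun h => hy'.2.2.1 (h ▸ hx'.2.1), fun h => hy'.2.2.1 (h ▸ hx.2.1),
        hy'.2.2.2, hy'.1, fun h => (hmem y' h).2.2 hy'.2.1⟩)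
  refine s4.represents ?_
  ext z
  rw [hWeq, hNu, hNv]
  simp only [Finset.mem_insert, Finset.mem_singleton]
  tauto

/-- A set of minimum degree at least three, with an edge such that the closed neighbourhoods of
its ends cover at most six vertices, is obtained by gluing. -/
theorem represents_of_card_union_le_six (hG : NoShortCycle G) {j n : ℕ} (hn : n < 32)
    (hW : W.card = n) (hno : NoSparse G W (j + 2))
    (hdeg : ∀ v ∈ W, 3 ≤ (nbrs G W v).card) {u v : V} (hu : u ∈ W) (hv : v ∈ W)
    (huv : G.Adj u v) (hs : (nbrs G W u ∪ nbrs G W v).card ≤ 6) :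
    (∃ m, n = m + 5 ∧ (nbrs G W u ∪ nbrs G W v).card = 5 ∧ ∀ L, Covers G j m L →
      Represents G W n (glueTriangle (j + 2) m L)) ∨
    (∃ m, n = m + 6 ∧ (nbrs G W u ∪ nbrs G W v).card = 6 ∧ ∀ L, Covers G j m L →
      Represents G W n (glueLargeTriangle (j + 2) m L) ∨
        Represents G W n (glueEdge (j + 2) m L)) := by
  have hsub : ∀ x, nbrs G W x ⊆ W := fun x y hy => (mem_nbrs.1 hy).1
  have hnoH := noSparse_sdiff_edge hno hu hv huv
  have hHcard := Finset.card_sdiff_add_card_eq_card (Finset.union_subset (hsub u) (hsub v))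
  have hcard := Finset.card_union_add_card_inter (nbrs G W u) (nbrs G W v)
  have hone := card_nbrs_inter_le_one (W := W) hG huv.ne
  have hdu := hdeg u hu
  have hdv := hdeg v hv
  by_cases h0 : (nbrs G W u ∩ nbrs G W v).card = 0
  · refine Or.inr ⟨n - 6, by omega, by omega, fun L hL => Or.inr ?_⟩
    have hR := hL _ (by omega) hnoH
    have h6 : n = n - 6 + 6 := by omega
    rw [h6]
    exact represents_of_edge hG (by omega) hno hu hv huv (by omega) (by omega)
      (Finset.disjoint_iff_inter_eq_empty.2 (Finset.card_eq_zero.1 h0)) hR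
  · -- The vertex of smaller degree, which is three, is called `a`.
    obtain ⟨w, hw⟩ := Finset.card_pos.1 (Nat.pos_of_ne_zero h0)
    rw [Finset.mem_inter] at hw
    have key : ∀ a ∈ W, ∀ b ∈ W, G.Adj a b → (nbrs G W a).card = 3 → w ∈ nbrs G W a →
        w ∈ nbrs G W b → ∀ m L,
        Represents G (W \ (nbrs G W a ∪ nbrs G W b)) m L → m + 6 ≤ 32 →
        ((nbrs G W b).card = 3 → Represents G W (m + 5) (glueTriangle (j + 2) m L)) ∧
        ((nbrs G W b).card = 4 → Represents G W (m + 6) (glueLargeTriangle (j + 2) m L)) := by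
      intro a ha b hb hab h3 hwa hwb m L hR hm
      have hbN : b ∈ nbrs G W a := mem_nbrs.2 ⟨hb, hab⟩
      have haN : a ∈ nbrs G W b := mem_nbrs.2 ⟨ha, hab.symm⟩
      have hwb' : w ≠ b := fun h => G.loopless.irrefl b (mem_nbrs.1 (h ▸ hwb)).2
      have hwa' : w ≠ a := fun h => G.loopless.irrefl a (mem_nbrs.1 (h ▸ hwa)).2
      have hwE : w ∈ (nbrs G W a).erase b := Finset.mem_erase.2 ⟨hwb', hwa⟩
      have hwE' : w ∈ (nbrs G W b).erase a := Finset.mem_erase.2 ⟨hwa', hwb⟩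
      obtain ⟨x, hx⟩ := Finset.card_eq_one.1
        (show (((nbrs G W a).erase b).erase w).card = 1 by
          rw [Finset.card_erase_of_mem hwE, Finset.card_erase_of_mem hbN, h3])
      have hxm : x ∈ ((nbrs G W a).erase b).erase w := hx ▸ Finset.mem_singleton_self x
      rw [Finset.mem_erase, Finset.mem_erase] at hxm
      have hYcard : (((nbrs G W b).erase a).erase w).card = (nbrs G W b).card - 2 := by
        rw [Finset.card_erase_of_mem hwE', Finset.card_erase_of_mem haN]
        omega
      have := represents_of_triangle (Y := ((nbrs G W b).erase a).erase w) hG hm hno ha hb hab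
        (by rw [← hx, Finset.insert_erase hwE, Finset.insert_erase hbN])
        (by rw [Finset.insert_erase hwE', Finset.insert_erase haN])
        hwb'.symm hxm.2.1.symm hxm.1.symm
        (fun y hy => by
          rw [Finset.mem_erase, Finset.mem_erase] at hy
          exact ⟨hy.2.1, hy.1⟩) hR
      rw [hYcard] at this
      exact ⟨fun h => this.1 (by omega), fun h => this.2 (by omega)⟩
    by_cases h5 : (nbrs G W u ∪ nbrs G W v).card = 5
    · obtain ⟨m, rfl⟩ : ∃ m, n = m + 5 := ⟨n - 5, by omega⟩
      refine Or.inl ⟨m, rfl, h5, fun L hL => ?_⟩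
      have hR := hL _ (by omega) hnoH
      exact (key u hu v hv huv (by omega) hw.1 hw.2 m _ hR (by omega)).1 (by omega)
    · obtain ⟨m, rfl⟩ : ∃ m, n = m + 6 := ⟨n - 6, by omega⟩
      refine Or.inr ⟨m, rfl, by omega, fun L hL => Or.inl ?_⟩
      have hR := hL _ (by omega) hnoH
      obtain h3 | h3 : (nbrs G W u).card = 3 ∨ (nbrs G W v).card = 3 := by omega
      · exact (key u hu v hv huv h3 hw.1 hw.2 m _ hR (by omega)).2 (by omega)
      · rw [Finset.union_comm] at hR
        exact (key v hv u hu huv.symm h3 hw.2 hw.1 m _ hR (by omega)).2 (by omega)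

end GraphCode

namespace GraphCode

/-! ### Lists of small graphs

Each list contains one code for every isomorphism class. The theorems below are the steps from
the graph on a single vertex to `codeG₄`. -/

/-- The graph on one vertex. -/
def codes1 : List ℕ :=
  [0]

/-- The graphs on two vertices. -/
def codes2 : List ℕ :=
  [0, 4294967298]

/-- The graphs on three vertices. -/
def codes3 : List ℕ :=
  [55340232242603491334, 0, 36893488164598972416, 55340232238308524036]

/-- The graphs on four vertices without cycles of length four and without a `4`-set inducing a
matching. -/
def codes44 : List ℕ :=
  [396140812755789128721995137032, 475368975233159978185299853312, 554597137747424315778843803656,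
   55340232242603491334, 316912650259971535206455705606]

/-- The graphs on four vertices without cycles of length four. -/
def codes54 : List ℕ :=
  [79228162551157825758142922760, 396140812755789128721995137032, 0,
   316912650204631302963852214272, 475368975233159978185299853312, 554597137747424315778843803656,
   55340232242603491334, 316912650259971535206455705606]

/-- The graphs on five vertices without cycles of length four and five and without a
`5`-set inducing a matching. -/
def codes55 : List ℕ :=
  [4083388404635824812288503898821126782976, 4763953138477701739215253113753382682624,
   5104235505398640202678627721185150894096, 4083388404318912162083872595857274568704,
   4763953138160789089010621810789530468352, 5104235505081727552473996418221298679824,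
   396140812755789128721995137032, 2722258937031299120691015389672844034056,
   4083388404715052974839661724579269705736, 2722258936714386470486384086708991819784,
   3062541303635324933949758694140760031256, 4083388404398140324635030421615417491464,
   4763953138240017251561779636547673391112, 5104235505160955715025154243979441602584]

/-- The graphs on six vertices without cycles of length four and five and without a
`5`-set inducing a matching. -/
def codes56 : List ℕ :=
  [4384504916076097159009194822783879480720654073896,
   8769009827047958812857433930837752622572499894296,
   32153036035231441245586422085126268374884003348504,
   26307029482845288269532498632476870920482802630664,
   40922045856154317454104648160686455730256801169416,
   4384504916076097158929966660232721654962511151136,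
   16076518014723320507094746522419444615203377905696,
   27768531124259579591658954814521237407274014605344,
   11692013103751458853563420064865350681426017648656,
   4384504916756661893088756237364102172858619265056,
   11692013103411176486642481601401976073994249437184,
   13153514740742079404846166434118259093650181980192,
   27768531124940144325817744391652617925170122719264,
   4384504916076097159246879310437352957926363365408,
   27768531124259579591975867464725868710237866819616]

/-- The graphs on seven vertices without cycles of length four and five and without a
`5`-set inducing a matching. -/
def codes57 : List ℕ :=
  [364071900750348094029507741958021112150580343173751051911200,
   106710729527880602489831779947002889367872888352004554883144,
   213421459101067755675670724313105682264106077850752388169768]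

/-- The graphs on nine vertices without cycles of length four and five and without a
`6`-set inducing a matching. -/
def codes69 : List ℕ :=
  [23274209946621815656059610497785595682948191148989733113356334266922512632774920,
   10189703855525899973065416447221845497510169551745677202325291662442408154497064,
   17600397570973808051386774967856385611736846131893623044682320972142552230658088,
   18642526374109653810349564274958001539839711872637404211849006376642207878742304]

/-- The graphs on twelve vertices without cycles of length four and five and without a
`7`-set inducing a matching. -/
def codes712 : List ℕ :=
  [10577615621598389575945980857253975699248525134929547089359185369555120918409316938331200759437342838376892440,
   14274735392210550923544685517319211212963044607592025956822933428949143838447961514791933117396803754678812960,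
   4999826984635497110725563722690832958405450986136566490413427449303562846953296442184140975507612956752873512]

/-- The code of `SimpleGraph.G₄`. -/
def codeG₄ : ℕ :=
  368551018172974055467544712590311036772845119660584125869699550116789218409333152803986572314374329531883409984047526498119440251836345089397867988897759559374218465294

theorem codes1_four :
    allMemIso 1 codes1 (extensions 4 0 0 0 [0]) = true := by
  decide +kernel

theorem codes2_four :
    allMemIso 2 codes2 (extensions 4 1 0 0 codes1) = true := by
  decide +kernel

theorem codes3_four :
    allMemIso 3 codes3 (extensions 4 2 0 0 codes2) = true := by
  decide +kernel

theorem codes44_four :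
    allMemIso 4 codes44 (extensions 4 3 0 0 codes3) = true := by
  decide +kernel

theorem codes1_five :
    allMemIso 1 codes1 (extensions 5 0 0 0 [0]) = true := by
  decide +kernel

theorem codes2_five :
    allMemIso 2 codes2 (extensions 5 1 0 0 codes1) = true := by
  decide +kernel

theorem codes3_five :
    allMemIso 3 codes3 (extensions 5 2 0 0 codes2) = true := by
  decide +kernel

theorem codes54_five :
    allMemIso 4 codes54 (extensions 5 3 0 0 codes3) = true := by
  decide +kernel

theorem codes55_five :
    allMemIso 5 codes55 (extensions 5 4 0 0 codes54) = true := by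
  decide +kernel

theorem codes56_five :
    allMemIso 6 codes56 (extensions 5 5 0 0 codes55) = true := by
  decide +kernel

theorem codes57_five :
    allMemIso 7 codes57 (extensions 5 6 0 0 codes56) = true := by
  decide +kernel

theorem extensions_codes57 :
    extensions 5 7 0 0 codes57 = [] := by
  decide +kernel

theorem glueDegreeOne_codes57 :
    allMemIso 9 codes69 (glueDegreeOne 6 7 codes57) = true := by
  decide +kernel

theorem glueDegreeTwo_codes56 :
    allMemIso 9 codes69 (glueDegreeTwo 6 6 codes56) = true := by
  decide +kernel

theorem glueTriangle_codes44 :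
    allMemIso 9 codes69 (glueTriangle 6 4 codes44) = true := by
  decide +kernel

theorem extensions_codes69 :
    extensions 6 9 0 0 codes69 = [] := by
  decide +kernel

theorem glueDegreeTwo_codes69 :
    allMemIso 12 codes712 (glueDegreeTwo 7 9 codes69) = true := by
  decide +kernel

theorem glueTriangle_codes57 :
    allMemIso 12 codes712 (glueTriangle 7 7 codes57) = true := by
  decide +kernel

theorem extensions_codes712 :
    extensions 7 12 0 0 codes712 = [] := by
  decide +kernel

theorem glueDegreeTwo_codes712 :
    glueDegreeTwo 8 12 codes712 = [] := by
  decide +kernel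

theorem glueEdge_codes69 :
    glueEdge 8 9 codes69 = [] := by
  decide +kernel

theorem glueLargeTriangle_codes69 :
    glueLargeTriangle 8 9 codes69 = [] := by
  decide +kernel

theorem glueEdge_codes712 :
    allMemIso 18 [codeG₄] (glueEdge 9 12 codes712) = true := by
  decide +kernel

theorem glueLargeTriangle_codes712 :
    allMemIso 18 [codeG₄] (glueLargeTriangle 9 12 codes712) = true := by
  decide +kernel

theorem extensions_codeG₄ :
    extensions 9 18 0 0 [codeG₄] = [] := by
  decide +kernel

end GraphCode

namespace GraphCode

/-! ### The extremal sets without short cycles -/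

variable {V : Type*} [DecidableEq V] {G : SimpleGraph V}

theorem not_represents_nil {W : Finset V} {n : ℕ} : ¬ Represents G W n [] := by
  rintro ⟨-, -, A, hA, -⟩
  exact List.not_mem_nil hA

/-- If `n` vertices always contain `j` vertices inducing a matching, then so do more vertices. -/
theorem Covers.nil_mono {j n m : ℕ} (h : Covers G j n []) (hnm : n ≤ m) : Covers G j m [] := by
  intro W hW hno
  have := h.card_lt hno
  omega

theorem exists_adj_card_union_le {W : Finset V} (hG : NoShortCycle G) (hne : W.Nonempty)
    (hdeg : ∀ v ∈ W, 3 ≤ (nbrs G W v).card) {t : ℕ}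
    (ht : W.card ≤ 12 ∧ t = 5 ∨ W.card ≤ 18 ∧ t = 6) :
    ∃ u ∈ W, ∃ v ∈ W, G.Adj u v ∧ (nbrs G W u ∪ nbrs G W v).card ≤ t := by
  by_contra! hc
  have := lt_card_of_forall_le_card_union hG (t := t + 1) hne hdeg hc
  omega

variable [Nonempty V]

theorem covers_four_four (hG : NoShortCycle G) : Covers G 4 4 codes44 :=
  have h1 := ((covers_zero G 4).extensions hG (by omega)).of_allMemIso (by omega) codes1_four
  have h2 := (h1.extensions hG (by omega)).of_allMemIso (by omega) codes2_four
  have h3 := (h2.extensions hG (by omega)).of_allMemIso (by omega) codes3_four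
  (h3.extensions hG (by omega)).of_allMemIso (by omega) codes44_four

theorem covers_five_six (hG : NoShortCycle G) : Covers G 5 6 codes56 :=
  have h1 := ((covers_zero G 5).extensions hG (by omega)).of_allMemIso (by omega) codes1_five
  have h2 := (h1.extensions hG (by omega)).of_allMemIso (by omega) codes2_five
  have h3 := (h2.extensions hG (by omega)).of_allMemIso (by omega) codes3_five
  have h4 := (h3.extensions hG (by omega)).of_allMemIso (by omega) codes54_five
  have h5 := (h4.extensions hG (by omega)).of_allMemIso (by omega) codes55_five
  (h5.extensions hG (by omega)).of_allMemIso (by omega) codes56_five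

theorem covers_five_seven (hG : NoShortCycle G) : Covers G 5 7 codes57 :=
  ((covers_five_six hG).extensions hG (by omega)).of_allMemIso (by omega) codes57_five

theorem covers_five_eight (hG : NoShortCycle G) : Covers G 5 8 [] :=
  extensions_codes57 ▸ (covers_five_seven hG).extensions hG (by omega)

theorem covers_six_nine (hG : NoShortCycle G) : Covers G 6 9 codes69 := by
  intro W hW hno
  by_cases hdeg : ∀ v ∈ W, 3 ≤ (nbrs G W v).card
  · obtain ⟨u, hu, v, hv, huv, h5⟩ := exists_adj_card_union_le hG
      (Finset.card_pos.1 (by omega)) hdeg (Or.inl ⟨by omega, rfl⟩)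
    obtain ⟨m, hm, -, h⟩ | ⟨m, -, h6, -⟩ := represents_of_card_union_le_six (j := 4) hG
      (by omega) hW hno hdeg hu hv huv (by omega)
    · obtain rfl : m = 4 := by omega
      exact (h _ (covers_four_four hG)).of_allMemIso (by omega) glueTriangle_codes44
    · omega
  · push Not at hdeg
    obtain ⟨v, hv, hd⟩ := hdeg
    obtain h | h := represents_of_card_nbrs_le_two (j := 5) (m := 6) hG (by omega)
      (fun W h => Nat.le_of_lt_succ ((covers_five_eight hG).card_lt h)) (covers_five_seven hG)
      (covers_five_six hG) hW hno hv (by omega)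
    · exact h.of_allMemIso (by omega) glueDegreeOne_codes57
    · exact h.of_allMemIso (by omega) glueDegreeTwo_codes56

theorem covers_six_ten (hG : NoShortCycle G) : Covers G 6 10 [] :=
  extensions_codes69 ▸ (covers_six_nine hG).extensions hG (by omega)

theorem covers_seven_twelve (hG : NoShortCycle G) : Covers G 7 12 codes712 := by
  intro W hW hno
  by_cases hdeg : ∀ v ∈ W, 3 ≤ (nbrs G W v).card
  · obtain ⟨u, hu, v, hv, huv, h5⟩ := exists_adj_card_union_le hG
      (Finset.card_pos.1 (by omega)) hdeg (Or.inl ⟨by omega, rfl⟩)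
    obtain ⟨m, hm, -, h⟩ | ⟨m, -, h6, -⟩ := represents_of_card_union_le_six (j := 5) hG
      (by omega) hW hno hdeg hu hv huv (by omega)
    · obtain rfl : m = 7 := by omega
      exact (h _ (covers_five_seven hG)).of_allMemIso (by omega) glueTriangle_codes57
    · omega
  · push Not at hdeg
    obtain ⟨v, hv, hd⟩ := hdeg
    obtain h | h := represents_of_card_nbrs_le_two (j := 6) (m := 9) hG (by omega)
      (fun W h => ((covers_six_ten hG).card_lt h).le) (covers_six_ten hG)
      (covers_six_nine hG) hW hno hv (by omega)
    · exact absurd h not_represents_nil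
    · exact h.of_allMemIso (by omega) glueDegreeTwo_codes69

theorem covers_seven_thirteen (hG : NoShortCycle G) : Covers G 7 13 [] :=
  extensions_codes712 ▸ (covers_seven_twelve hG).extensions hG (by omega)

theorem covers_eight_fifteen (hG : NoShortCycle G) : Covers G 8 15 [] := by
  intro W hW hno
  by_cases hdeg : ∀ v ∈ W, 3 ≤ (nbrs G W v).card
  · obtain ⟨u, hu, v, hv, huv, h6⟩ := exists_adj_card_union_le hG
      (Finset.card_pos.1 (by omega)) hdeg (Or.inr ⟨by omega, rfl⟩)
    obtain ⟨m, hm, -, h⟩ | ⟨m, hm, -, h⟩ := represents_of_card_union_le_six (j := 6) hG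
      (by omega) hW hno hdeg hu hv huv (by omega)
    · obtain rfl : m = 10 := by omega
      exact h _ (covers_six_ten hG)
    · obtain rfl : m = 9 := by omega
      obtain h | h := h _ (covers_six_nine hG)
      · rwa [glueLargeTriangle_codes69] at h
      · rwa [glueEdge_codes69] at h
  · push Not at hdeg
    obtain ⟨v, hv, hd⟩ := hdeg
    obtain h | h := represents_of_card_nbrs_le_two (j := 7) (m := 12) hG (by omega)
      (fun W h => ((covers_seven_thirteen hG).card_lt h).le) (covers_seven_thirteen hG)
      (covers_seven_twelve hG) hW hno hv (by omega)
    · exact h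
    · rwa [glueDegreeTwo_codes712] at h

/-- In a graph without short cycles, `18` vertices among which no `9` induce a matching induce a
copy of the graph coded by `codeG₄`. -/
theorem covers_nine_eighteen (hG : NoShortCycle G) : Covers G 9 18 [codeG₄] := by
  intro W hW hno
  have h15 := covers_eight_fifteen hG
  by_cases hdeg : ∀ v ∈ W, 3 ≤ (nbrs G W v).card
  · obtain ⟨u, hu, v, hv, huv, h6⟩ := exists_adj_card_union_le hG
      (Finset.card_pos.1 (by omega)) hdeg (Or.inr ⟨by omega, rfl⟩)
    obtain ⟨m, hm, -, h⟩ | ⟨m, hm, -, h⟩ := represents_of_card_union_le_six (j := 7) hG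
      (by omega) hW hno hdeg hu hv huv (by omega)
    · obtain rfl : m = 13 := by omega
      exact absurd (h _ (covers_seven_thirteen hG)) not_represents_nil
    · obtain rfl : m = 12 := by omega
      obtain h | h := h _ (covers_seven_twelve hG)
      · exact h.of_allMemIso (by omega) glueLargeTriangle_codes712
      · exact h.of_allMemIso (by omega) glueEdge_codes712
  · push Not at hdeg
    obtain ⟨v, hv, hd⟩ := hdeg
    obtain h | h := represents_of_card_nbrs_le_two (j := 8) (m := 15) hG (by omega)
      (fun W h => by have := h15.card_lt h; omega) (h15.nil_mono (by omega)) h15 hW hno hv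
      (by omega)
    · exact absurd h not_represents_nil
    · exact absurd h not_represents_nil

/-- In a graph without short cycles, among `19` vertices there are `9` inducing a matching. -/
theorem covers_nine_nineteen (hG : NoShortCycle G) : Covers G 9 19 [] :=
  extensions_codeG₄ ▸ (covers_nine_eighteen hG).extensions hG (by omega)

end GraphCode

/-! ### Perfect graphs without defective sets -/

namespace SimpleGraph

variable {V : Type*} {G : SimpleGraph V}

theorem isSparseSet_one_iff {S : Finset V} : G.IsSparseSet 1 S ↔ InducesMatching G S := by
  refine forall₂_congr fun v _ => ?_
  rw [Set.ncard_le_one (S.finite_toSet.inter_of_right _)]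
  simp only [Set.mem_inter_iff, mem_neighborSet, Finset.mem_coe]
  exact ⟨fun h a ha b hb hva hvb => h a ⟨hva, ha⟩ b ⟨hvb, hb⟩,
    fun h a ha b hb => h a ha.2 b hb.2 ha.1 hb.1⟩

/-- The four vertices of a cycle form a `1`-dense set, and an induced cycle of length five is not
perfect. -/
theorem IsPerfect.noShortCycle (hG : G.IsPerfect)
    (h4 : ∀ S : Finset V, S.card = 4 → ¬ InducesMatching Gᶜ S) : NoShortCycle G := by
  classical
  have four : ∀ a b c d, G.Adj a b → G.Adj b c → G.Adj c d → G.Adj d a → a ≠ c → b ≠ d →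
      False := by
    intro a b c d hab hbc hcd hda hac hbd
    refine h4 {a, b, c, d} ?_ ?_
    · rw [Finset.card_eq_succ]
      refine ⟨a, {b, c, d}, ?_, rfl, ?_⟩
      · simp [hab.ne, hac, hda.ne.symm]
      · exact Finset.card_eq_three.2 ⟨b, c, d, hbc.ne, hbd, hcd.ne, rfl⟩
    · have key : ∀ v ∈ ({a, b, c, d} : Finset V), ∀ x ∈ ({a, b, c, d} : Finset V),
          Gᶜ.Adj v x → (v = a ∧ x = c) ∨ (v = b ∧ x = d) ∨ (v = c ∧ x = a) ∨ (v = d ∧ x = b) := by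
        intro v hv x hx hvx
        rw [compl_adj] at hvx
        simp only [Finset.mem_insert, Finset.mem_singleton] at hv hx
        have := hab.symm
        have := hbc.symm
        have := hcd.symm
        have := hda.symm
        rcases hv with rfl | rfl | rfl | rfl <;> rcases hx with rfl | rfl | rfl | rfl <;>
          simp_all
      have := hab.ne
      have := hbc.ne
      have := hcd.ne
      have := hda.ne
      intro v hv x hx y hy hvx hvy
      have h1 := key v hv x hx hvx
      have h2 := key v hv y hy hvy
      grind
  refine ⟨four, fun a b c d e hab hbc hcd hde hea hac had hbd hbe hce => ?_⟩
  have nac : ¬ G.Adj a c := fun h => four a c d e h hcd hde hea had hce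
  have nbd : ¬ G.Adj b d := fun h => four b d e a h hde hea hab hbe had.symm
  have nce : ¬ G.Adj c e := fun h => four c e a b h hea hab hbc hac.symm hbe.symm
  have nda : ¬ G.Adj d a := fun h => four d a b c h hab hbc hcd hbd.symm hac
  have neb : ¬ G.Adj e b := fun h => four e b c d h hbc hcd hde hce.symm hbd
  set S : Set V := {a, b, c, d, e} with hS
  have hfin : Finite S := Set.toFinite S
  have hclique : (G.induce S).cliqueNum ≤ 2 := by
    by_contra! hc
    obtain ⟨s, hs⟩ := (G.induce S).exists_isNClique_cliqueNum
    obtain ⟨t, hts, ht⟩ := Finset.exists_subset_card_eq (hs.card_eq ▸ hc)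
    obtain ⟨x, y, z, hxy, hxz, hyz, rfl⟩ := Finset.card_eq_three.1 ht
    have hcl : ∀ p ∈ ({x, y, z} : Finset S), ∀ q ∈ ({x, y, z} : Finset S), p ≠ q →
        G.Adj p q := fun p hp q hq hpq => hs.isClique (hts hp) (hts hq) hpq
    have h1 := hcl x (by simp) y (by simp) hxy
    have h2 := hcl x (by simp) z (by simp) hxz
    have h3 := hcl y (by simp) z (by simp) hyz
    have hmem : ∀ p ∈ S, p = a ∨ p = b ∨ p = c ∨ p = d ∨ p = e := fun p hp => by
      simpa [hS] using hp
    -- A vertex of the cycle has two neighbours on it, and these are not adjacent.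
    have key : ∀ {p q r}, ¬ G.Adj q r → (∀ t ∈ S, G.Adj p t → t = q ∨ t = r) → (x : V) ≠ p := by
      rintro p q r hqr hp rfl
      obtain hy | hy := hp y y.2 h1 <;> obtain hz | hz := hp z z.2 h2 <;> rw [hy, hz] at h3
      · exact h3.ne rfl
      · exact hqr h3
      · exact hqr h3.symm
      · exact h3.ne rfl
    obtain h | h | h | h | h := hmem x x.2
    · refine key neb (fun t ht hat => ?_) h
      obtain rfl | rfl | rfl | rfl | rfl := hmem t ht
      exacts [absurd rfl hat.ne, Or.inr rfl, absurd hat nac, absurd hat.symm nda, Or.inl rfl]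
    · refine key nac (fun t ht hat => ?_) h
      obtain rfl | rfl | rfl | rfl | rfl := hmem t ht
      exacts [Or.inl rfl, absurd rfl hat.ne, Or.inr rfl, absurd hat nbd, absurd hat.symm neb]
    · refine key nbd (fun t ht hat => ?_) h
      obtain rfl | rfl | rfl | rfl | rfl := hmem t ht
      exacts [absurd hat.symm nac, Or.inl rfl, absurd rfl hat.ne, Or.inr rfl, absurd hat nce]
    · refine key nce (fun t ht hat => ?_) h
      obtain rfl | rfl | rfl | rfl | rfl := hmem t ht
      exacts [absurd hat nda, absurd hat.symm nbd, Or.inl rfl, absurd rfl hat.ne, Or.inr rfl]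
    · refine key nda (fun t ht hat => ?_) h
      obtain rfl | rfl | rfl | rfl | rfl := hmem t ht
      exacts [Or.inr rfl, absurd hat neb, absurd hat.symm nce, Or.inl rfl, absurd rfl hat.ne]
  have hcol : (G.induce S).Colorable 2 := by
    rw [← chromaticNumber_le_iff_colorable, hG S]
    exact_mod_cast hclique
  obtain ⟨C⟩ := hcol
  have ha : a ∈ S := by simp [hS]
  have hb : b ∈ S := by simp [hS]
  have hc : c ∈ S := by simp [hS]
  have hd : d ∈ S := by simp [hS]
  have he : e ∈ S := by simp [hS]
  have c1 : C ⟨a, ha⟩ ≠ C ⟨b, hb⟩ := C.valid hab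
  have c2 : C ⟨b, hb⟩ ≠ C ⟨c, hc⟩ := C.valid hbc
  have c3 : C ⟨c, hc⟩ ≠ C ⟨d, hd⟩ := C.valid hcd
  have c4 : C ⟨d, hd⟩ ≠ C ⟨e, he⟩ := C.valid hde
  have c5 : C ⟨e, he⟩ ≠ C ⟨a, ha⟩ := C.valid hea
  omega

/-- A graph is perfect if it is `3`-colourable and its triangle-free induced subgraphs are
`2`-colourable. -/
theorem isPerfect_of_colorings [Finite V] (h3 : G.Colorable 3)
    (h2 : ∀ S : Set V, (∀ a ∈ S, ∀ b ∈ S, ∀ c ∈ S, G.Adj a b → G.Adj a c → ¬ G.Adj b c) →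
      ∃ f : V → Bool, ∀ a ∈ S, ∀ b ∈ S, G.Adj a b → f a ≠ f b) : G.IsPerfect := by
  classical
  intro S
  refine le_antisymm ?_ cliqueNum_le_chromaticNumber
  have hle : ∀ {k : ℕ} (s : Finset S), (G.induce S).IsClique s → k ≤ s.card →
      (G.induce S).Colorable k → (G.induce S).chromaticNumber ≤ (G.induce S).cliqueNum :=
    fun s hs hk hcol => hcol.chromaticNumber_le.trans
      (by exact_mod_cast hk.trans (IsClique.card_le_cliqueNum (tc := hs)))
  by_cases ht : ∀ a ∈ S, ∀ b ∈ S, ∀ c ∈ S, G.Adj a b → G.Adj a c → ¬ G.Adj b c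
  · by_cases he : ∃ a b, (G.induce S).Adj a b
    · obtain ⟨a, b, hab⟩ := he
      obtain ⟨f, hf⟩ := h2 S ht
      refine hle {a, b} ?_ (Finset.card_pair hab.ne).ge ?_
      · rw [Finset.coe_pair, isClique_pair]
        exact fun _ => hab
      · exact (Coloring.mk (G := G.induce S) (fun x : S => f x)
          fun {x y} hxy => hf x x.2 y y.2 hxy).colorable
    · push Not at he
      by_cases hS : IsEmpty S
      · exact hle (k := 0) ∅ (by simp) le_rfl (Colorable.of_isEmpty _)
      · rw [not_isEmpty_iff] at hS
        obtain ⟨a⟩ := hS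
        exact hle {a} (by simp) (Finset.card_singleton a).ge
          ⟨Coloring.mk (fun _ => 0) fun {x y} hxy => absurd hxy (he x y)⟩
  · push Not at ht
    obtain ⟨a, ha, b, hb, c, hc, hab, hac, hbc⟩ := ht
    refine hle {⟨a, ha⟩, ⟨b, hb⟩, ⟨c, hc⟩} ?_ ?_ (h3.of_hom (Embedding.induce S).toHom)
    · rw [isClique_iff]
      simp [Set.Pairwise, hab, hac, hbc, hab.symm, hac.symm, hbc.symm]
    · rw [Finset.card_eq_three.2 ⟨_, _, _, ?_, ?_, ?_, rfl⟩]
      · simpa using hab.ne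
      · simpa using hac.ne
      · simpa using hbc.ne

end SimpleGraph

namespace GraphCode

/-! ### Exhaustive search for sets inducing a matching -/

/-- Whether no `need` vertices below `n` extend the set `S` of larger vertices to a set inducing a
matching. -/
noncomputable def noSparseSearch (A n : ℕ) : ℕ → ℕ → Bool :=
  Nat.rec (fun _ need => Nat.ble 1 need)
    (fun i ih S need => Bool.rec true
      (Bool.rec false
        (force (Nat.land (row A i) S) fun w => Bool.rec
          (Bool.rec true (ih (Nat.lor S (Nat.shiftLeft 1 i)) (Nat.sub need 1))
            (Bool.rec false (Nat.beq (Nat.land (row A (Nat.log2 w)) S) 0)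
              (Nat.beq w (Nat.shiftLeft 1 (Nat.log2 w)))))
          (ih (Nat.lor S (Nat.shiftLeft 1 i)) (Nat.sub need 1)) (Nat.beq w 0))
        (ih S need))
      (Nat.ble need (Nat.succ i))) n

theorem noSparseSearch_succ (A i S need : ℕ) :
    noSparseSearch A (i + 1) S need =
      (!Nat.ble need (i + 1) || (noSparseSearch A i S need &&
        (!(Nat.beq (row A i &&& S) 0 ||
            (Nat.beq (row A i &&& S) (1 <<< (row A i &&& S).log2) &&
              Nat.beq (row A (row A i &&& S).log2 &&& S) 0)) ||
          noSparseSearch A i (S ||| 1 <<< i) (need - 1)))) := by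
  change (Bool.rec true (Bool.rec false (force (Nat.land (row A i) S) fun w => Bool.rec
    (Bool.rec true (noSparseSearch A i (Nat.lor S (Nat.shiftLeft 1 i)) (Nat.sub need 1))
      (Bool.rec false (Nat.beq (Nat.land (row A (Nat.log2 w)) S) 0)
        (Nat.beq w (Nat.shiftLeft 1 (Nat.log2 w)))))
    (noSparseSearch A i (Nat.lor S (Nat.shiftLeft 1 i)) (Nat.sub need 1)) (Nat.beq w 0))
    (noSparseSearch A i S need)) (Nat.ble need (Nat.succ i)) : Bool) = _
  rw [force_eq]
  change (Bool.rec true (Bool.rec false (Bool.rec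
    (Bool.rec true (noSparseSearch A i (S ||| 1 <<< i) (need - 1))
      (Bool.rec false (Nat.beq (row A (row A i &&& S).log2 &&& S) 0)
        (Nat.beq (row A i &&& S) (1 <<< (row A i &&& S).log2))))
    (noSparseSearch A i (S ||| 1 <<< i) (need - 1)) (Nat.beq (row A i &&& S) 0))
    (noSparseSearch A i S need)) (Nat.ble need (i + 1)) : Bool) = _
  cases Nat.ble need (i + 1) <;> cases noSparseSearch A i S need <;>
    cases Nat.beq (row A i &&& S) 0 <;>
    cases Nat.beq (row A i &&& S) (1 <<< (row A i &&& S).log2) <;>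
    cases Nat.beq (row A (row A i &&& S).log2 &&& S) 0 <;> rfl

theorem noSparseSearch_eq_false {A : ℕ} {T : Finset ℕ}
    (hsymm : ∀ a ∈ T, ∀ b ∈ T, (row A a).testBit b = true → (row A b).testBit a = true)
    (hT : ∀ v ∈ T, ∀ a ∈ T, ∀ b ∈ T, (row A v).testBit a = true → (row A v).testBit b = true →
      a = b) (n : ℕ) : ∀ S, (∀ b, S.testBit b = true ↔ b ∈ T ∧ n ≤ b) →
    noSparseSearch A n S (T.filter (· < n)).card = false := by
  induction n with
  | zero =>
    intro S _
    have : T.filter (· < 0) = ∅ := by simp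
    rw [this]
    rfl
  | succ i ih =>
    intro S hS
    have hble : Nat.ble (T.filter (· < i + 1)).card (i + 1) = true := by
      refine Nat.ble_eq_true_of_le ((Finset.card_le_card (t := Finset.range (i + 1)) ?_).trans_eq
        (Finset.card_range _))
      intro x hx
      exact Finset.mem_range.2 (Finset.mem_filter.1 hx).2
    rw [noSparseSearch_succ, hble]
    by_cases hi : i ∈ T
    · have hcard : (T.filter (· < i + 1)).card = (T.filter (· < i)).card + 1 := by
        rw [← Finset.card_insert_of_notMem (a := i) (s := T.filter (· < i)) (by simp)]
        congr 1
        ext x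
        simp only [Finset.mem_filter, Finset.mem_insert]
        constructor
        · rintro ⟨h1, h2⟩
          rcases Nat.lt_succ_iff_lt_or_eq.1 h2 with h | h
          · exact Or.inr ⟨h1, h⟩
          · exact Or.inl h
        · rintro (rfl | h)
          · exact ⟨hi, Nat.lt_succ_self _⟩
          · exact ⟨h.1, by omega⟩
      have hrec := ih (S ||| 1 <<< i) fun b => by
        rw [Nat.testBit_or, Bool.or_eq_true, Nat.one_shiftLeft, Nat.testBit_two_pow,
          decide_eq_true_eq, hS]
        constructor
        · rintro (h | rfl)
          · exact ⟨h.1, by omega⟩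
          · exact ⟨hi, le_rfl⟩
        · rintro ⟨h1, h2⟩
          rcases Nat.eq_or_lt_of_le h2 with rfl | h
          · exact Or.inr rfl
          · exact Or.inl ⟨h1, h⟩
      rw [hcard, Nat.add_sub_cancel, hrec]
      have hok : (Nat.beq (row A i &&& S) 0 ||
          (Nat.beq (row A i &&& S) (1 <<< (row A i &&& S).log2) &&
            Nat.beq (row A (row A i &&& S).log2 &&& S) 0)) = true := by
        by_cases h0 : row A i &&& S = 0
        · rw [h0]
          rfl
        · have hlog := Nat.testBit_log2 h0
          set p := (row A i &&& S).log2
          have hmem : ∀ b, (row A i &&& S).testBit b = true →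
              (row A i).testBit b = true ∧ b ∈ T ∧ i + 1 ≤ b := fun b hb => by
            rw [Nat.testBit_and, Bool.and_eq_true, hS] at hb
            exact hb
          obtain ⟨hip, hp, -⟩ := hmem p hlog
          have h1 : row A i &&& S = 1 <<< p := Nat.eq_of_testBit_eq fun b => by
            rw [Bool.eq_iff_iff, Nat.one_shiftLeft, Nat.testBit_two_pow, decide_eq_true_eq]
            constructor
            · intro hb
              exact hT i hi p hp b (hmem b hb).2.1 hip (hmem b hb).1
            · rintro rfl
              exact hlog
          have h2 : row A p &&& S = 0 := Nat.eq_of_testBit_eq fun b => by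
            rw [Nat.zero_testBit, Bool.eq_false_iff]
            intro hb
            rw [Nat.testBit_and, Bool.and_eq_true, hS] at hb
            have := hT p hp i hi b hb.2.1 (hsymm i hi p hp hip) hb.1
            omega
          rw [h2, h1]
          simp
      rw [hok]
      simp
    · have hfil : T.filter (· < i + 1) = T.filter (· < i) := Finset.filter_congr fun x hx => by
        have : x ≠ i := fun h => hi (h ▸ hx)
        omega
      rw [hfil, ih S fun b => by
        rw [hS]
        refine and_congr_right fun hb => ?_
        have : b ≠ i := fun h => hi (h ▸ hb)
        omega]
      simp

/-! ### Two-colourings of the subgraphs without triangles -/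

/-- One colour class of a proper `2`-colouring of the graph induced on a set of vertices, if there
is one; `rest` is the set of the vertices not yet coloured, `F` the set of those coloured last,
`X` the colour class containing `F` and `Y` the other one. Nothing is proved about this search:
the colouring is checked afterwards. -/
noncomputable def colorSearch (A k : ℕ) : ℕ → ℕ → ℕ → ℕ → ℕ :=
  Nat.rec (fun _ X _ _ => X)
    (fun _ ih rest X Y F =>
      force (Nat.land (orBits (row A) 32 F 0) rest) fun N => Bool.rec
        (force (Nat.sub rest N) fun rest' => force (Nat.lor Y N) fun X' => ih rest' X' X N)
        (Bool.rec
          (force (Nat.shiftLeft 1 (Nat.log2 rest)) fun b =>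
            force (Nat.sub rest b) fun rest' => force (Nat.lor X b) fun X' => ih rest' X' Y b)
          X (Nat.beq rest 0))
        (Nat.beq N 0)) k

/-- Whether no two vertices in `X` are adjacent. -/
noncomputable def isIndependent (A X : ℕ) : Bool :=
  Nat.beq (Nat.land (orBits (row A) 32 X 0) X) 0

/-- Whether `m ∩ X` and `m \ X` are independent sets. -/
noncomputable def checkColoring (A m X : ℕ) : Bool :=
  force (Nat.land m X) fun Y => Bool.rec false (isIndependent A (Nat.xor m Y)) (isIndependent A Y)

theorem not_testBit_row_of_isIndependent {A X a b : ℕ} (hX : X < 2 ^ 32)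
    (h : isIndependent A X = true) (ha : X.testBit a = true) (hb : X.testBit b = true) :
    ¬ (row A a).testBit b = true := by
  intro hab
  have h0 : orBits (row A) 32 X 0 &&& X = 0 := Nat.eq_of_beq_eq_true h
  have h1 : (orBits (row A) 32 X 0 &&& X).testBit b = true := by
    rw [Nat.testBit_and, hb, Bool.and_true, testBit_orBits _ _ _ _ hX]
    exact Or.inr ⟨a, ha, hab⟩
  rw [h0, Nat.zero_testBit] at h1
  exact Bool.false_ne_true h1

theorem testBit_ne_of_checkColoring {A m X : ℕ} (hm : m < 2 ^ 32)
    (h : checkColoring A m X = true) {a b : ℕ} (ha : m.testBit a = true) (hb : m.testBit b = true)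
    (hab : (row A a).testBit b = true) : X.testBit a ≠ X.testBit b := by
  rw [checkColoring, force_eq] at h
  cases h1 : isIndependent A (m &&& X) with
  | false =>
    change (Bool.rec false _ (isIndependent A (m &&& X)) : Bool) = true at h
    rw [h1] at h
    exact absurd h Bool.false_ne_true
  | true =>
    change (Bool.rec false (isIndependent A (m ^^^ (m &&& X))) (isIndependent A (m &&& X)) : Bool) =
      true at h
    rw [h1] at h
    have hand : m &&& X < 2 ^ 32 := lt_of_le_of_lt Nat.and_le_left hm
    intro he
    cases hXa : X.testBit a with
    | true =>
      exact not_testBit_row_of_isIndependent hand h1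
        (by rw [Nat.testBit_and, ha, hXa]; rfl) (by rw [Nat.testBit_and, hb, ← he, hXa]; rfl) hab
    | false =>
      exact not_testBit_row_of_isIndependent (Nat.xor_lt_two_pow hm hand) h
        (by rw [Nat.testBit_xor, Nat.testBit_and, ha, hXa]; rfl)
        (by rw [Nat.testBit_xor, Nat.testBit_and, hb, ← he, hXa]; rfl) hab

/-- Whether all members of `t` are in the set `m`. -/
noncomputable def allIn (m : ℕ) (t : List ℕ) : Bool :=
  List.rec true (fun x _ r => Bool.rec false r (hasBit m x)) t

/-- Whether `p` holds for all sets obtained from `m` by removing a member of `t`. -/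
noncomputable def allRemove (p : ℕ → Bool) (m : ℕ) (t : List ℕ) : Bool :=
  List.rec true (fun x _ r => Bool.rec false r (force (clearBit m x) p)) t

/-- Whether for all ways to remove from `m` a member of each set in `ts`, a `2`-colouring of the
remaining set is found. -/
noncomputable def colorAll (A : ℕ) (ts : List (List ℕ)) : ℕ → Bool :=
  List.rec (fun m => checkColoring A m (colorSearch A 64 m 0 0 0))
    (fun t _ ih m => Bool.rec (ih m) (allRemove ih m t) (allIn m t)) ts

theorem of_allRemove {p : ℕ → Bool} {m x : ℕ} {t : List ℕ} (h : allRemove p m t = true)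
    (hx : x ∈ t) : p (clearBit m x) = true := by
  induction t with
  | nil => simp at hx
  | cons y t ih =>
    have hstep : allRemove p m (y :: t) =
      Bool.rec false (allRemove p m t) (force (clearBit m y) p) := rfl
    rw [hstep, force_eq] at h
    cases hy : p (clearBit m y) with
    | false =>
      rw [hy] at h
      exact absurd h Bool.false_ne_true
    | true =>
      rw [hy] at h
      rcases List.mem_cons.1 hx with rfl | hx
      · exact hy
      · exact ih h hx

theorem exists_coloring_of_colorAll {A : ℕ} {S : Set ℕ} (ts : List (List ℕ)) : ∀ m, m < 2 ^ 32 →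
    colorAll A ts m = true → (∀ a ∈ S, m.testBit a = true) → (∀ t ∈ ts, ∃ x ∈ t, x ∉ S) →
    ∃ X : ℕ, ∀ a ∈ S, ∀ b ∈ S, (row A a).testBit b = true → X.testBit a ≠ X.testBit b := by
  induction ts with
  | nil =>
    intro m hm h hS _
    exact ⟨_, fun a ha b hb hab => testBit_ne_of_checkColoring hm h (hS a ha) (hS b hb) hab⟩
  | cons t ts ih =>
    intro m hm h hS hts
    have hts' := fun t' ht' => hts t' (List.mem_cons_of_mem _ ht')
    have hstep : colorAll A (t :: ts) m =
      Bool.rec (colorAll A ts m) (allRemove (colorAll A ts) m t) (allIn m t) := rfl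
    rw [hstep] at h
    cases hin : allIn m t with
    | false =>
      rw [hin] at h
      exact ih m hm h hS hts'
    | true =>
      rw [hin] at h
      obtain ⟨x, hx, hxS⟩ := hts t List.mem_cons_self
      refine ih (clearBit m x) (Nat.lt_pow_two_of_testBit _ fun i hi => ?_) (of_allRemove h hx)
        (fun a ha => ?_) hts'
      · rw [testBit_clearBit, Nat.testBit_lt_two_pow
          (lt_of_lt_of_le hm (Nat.pow_le_pow_right (by omega) hi)), Bool.false_and]
      · have : x ≠ a := fun h => hxS (h ▸ ha)
        rw [testBit_clearBit, hS a ha, decide_eq_false this]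
        rfl

end GraphCode

namespace SimpleGraph

/-! ### The graph `G₄` -/

open GraphCode

theorem adj_G₄ (a b : Fin 18) : G₄.Adj a b ↔ a ≠ b ∧ ((a, b) ∈ edgesG₄ ∨ (b, a) ∈ edgesG₄) :=
  Iff.rfl

instance : DecidableRel G₄.Adj := fun a b => decidable_of_iff _ (adj_G₄ a b).symm

theorem testBit_codeG₄ :
    ∀ a b : Fin 18, codeG₄.testBit (32 * a + b) = decide (G₄.Adj a b) := by
  decide +kernel

theorem testBit_row_codeG₄ (a b : Fin 18) : (row codeG₄ a).testBit b = true ↔ G₄.Adj a b := by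
  rw [testBit_row, decide_eq_true (by omega), Bool.true_and, testBit_codeG₄, decide_eq_true_eq]

/-- The ten triangles of `G₄`. -/
def trianglesG₄ : List (Fin 18 × Fin 18 × Fin 18) :=
  [(0, 1, 2), (3, 4, 5), (6, 7, 8), (9, 10, 11), (0, 3, 12), (1, 6, 13), (2, 9, 14), (4, 7, 15),
   (5, 10, 16), (8, 11, 17)]

theorem adj_of_mem_trianglesG₄ : ∀ t ∈ trianglesG₄,
    G₄.Adj t.1 t.2.1 ∧ G₄.Adj t.1 t.2.2 ∧ G₄.Adj t.2.1 t.2.2 := by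
  have h : (trianglesG₄.all fun t => decide
      (G₄.Adj t.1 t.2.1 ∧ G₄.Adj t.1 t.2.2 ∧ G₄.Adj t.2.1 t.2.2)) = true := by
    decide +kernel
  exact fun t ht => of_decide_eq_true (List.all_eq_true.1 h t ht)

theorem colorAll_G₄ : colorAll codeG₄
    (trianglesG₄.map fun t => [t.1.val, t.2.1.val, t.2.2.val]) (2 ^ 18 - 1) = true := by
  decide +kernel

theorem noSparseSearch_G₄ : noSparseSearch codeG₄ 18 0 9 = true := by
  decide +kernel

/-- A proper `3`-colouring of `G₄`. -/
def coloringG₄ : Fin 18 → Fin 3 :=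
  ![0, 1, 2, 1, 0, 2, 0, 2, 1, 1, 0, 2, 2, 2, 0, 1, 1, 0]

theorem coloringG₄_ne : ∀ a b, G₄.Adj a b → coloringG₄ a ≠ coloringG₄ b := by
  decide +kernel

theorem noFourCycle_G₄ : ∀ a b, G₄.Adj a b → ∀ c, G₄.Adj b c → a ≠ c → ∀ d, G₄.Adj c d →
    G₄.Adj d a → b = d := by
  decide +kernel

end SimpleGraph

namespace SimpleGraph

open GraphCode

theorem noSparse_G₄ (T : Finset (Fin 18)) (hT : T.card = 9) : ¬ InducesMatching G₄ T := by
  intro hm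
  have hmem : ∀ x, x ∈ T.map Fin.valEmbedding → ∃ x' ∈ T, (x' : ℕ) = x := by
    intro x hx
    simpa using hx
  have hlt : ∀ x ∈ T.map Fin.valEmbedding, x < 18 := by
    intro x hx
    obtain ⟨x', -, rfl⟩ := hmem x hx
    exact x'.2
  have h := noSparseSearch_eq_false (A := codeG₄) (T := T.map Fin.valEmbedding) ?_ ?_ 18 0 ?_
  · rw [Finset.filter_true_of_mem hlt, Finset.card_map, hT, noSparseSearch_G₄] at h
    exact Bool.false_ne_true h.symm
  · intro a ha b hb hab
    obtain ⟨a, -, rfl⟩ := hmem a ha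
    obtain ⟨b, -, rfl⟩ := hmem b hb
    rw [testBit_row_codeG₄] at hab ⊢
    exact hab.symm
  · intro v hv a ha b hb hva hvb
    obtain ⟨v, hv', rfl⟩ := hmem v hv
    obtain ⟨a, ha', rfl⟩ := hmem a ha
    obtain ⟨b, hb', rfl⟩ := hmem b hb
    rw [testBit_row_codeG₄] at hva hvb
    rw [hm v hv' a ha' b hb' hva hvb]
  · intro b
    rw [Nat.zero_testBit]
    constructor
    · exact fun h => absurd h Bool.false_ne_true
    · exact fun h => absurd (hlt b h.1) (not_lt.2 h.2)

/-- Pulling back `G₄` along any map gives a perfect graph. -/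
theorem isPerfect_comap_G₄ {V : Type*} [Finite V] (e : V → Fin 18) : (G₄.comap e).IsPerfect := by
  refine isPerfect_of_colorings ?_ fun S hS => ?_
  · exact ⟨Coloring.mk (fun v => coloringG₄ (e v)) fun {v w} h => coloringG₄_ne _ _ h⟩
  · have hts : ∀ t ∈ trianglesG₄.map fun t => [t.1.val, t.2.1.val, t.2.2.val],
        ∃ x ∈ t, x ∉ (fun v => (e v : ℕ)) '' S := by
      intro t ht
      obtain ⟨⟨a, b, c⟩, habc, rfl⟩ := List.mem_map.1 ht
      obtain ⟨hab, hac, hbc⟩ := adj_of_mem_trianglesG₄ _ habc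
      by_contra! hall
      obtain ⟨x, hx, hxa⟩ := hall a (by simp)
      obtain ⟨y, hy, hyb⟩ := hall b (by simp)
      obtain ⟨z, hz, hzc⟩ := hall c (by simp)
      obtain rfl := Fin.ext hxa
      obtain rfl := Fin.ext hyb
      obtain rfl := Fin.ext hzc
      exact hS x hx y hy z hz hab hac hbc
    have hS' : ∀ a ∈ (fun v => (e v : ℕ)) '' S, (2 ^ 18 - 1).testBit a = true := by
      rintro - ⟨v, -, rfl⟩
      rw [Nat.testBit_two_pow_sub_one]
      exact decide_eq_true (e v).2
    obtain ⟨X, hX⟩ := exists_coloring_of_colorAll _ _ (by norm_num) colorAll_G₄ hS' hts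
    exact ⟨fun v => X.testBit (e v), fun a ha b hb hab =>
      hX _ ⟨a, ha, rfl⟩ _ ⟨b, hb, rfl⟩ ((testBit_row_codeG₄ _ _).2 hab)⟩

theorem isPerfect_G₄ : G₄.IsPerfect := isPerfect_comap_G₄ id

theorem noDense_G₄ (T : Finset (Fin 18)) (hT : T.card = 4) : ¬ InducesMatching G₄ᶜ T := by
  intro hm
  have hadj : ∀ x ∈ T, ∀ y ∈ T, ∀ z ∈ T, x ≠ y → x ≠ z → y ≠ z → G₄.Adj x y ∨ G₄.Adj x z := by
    intro x hx y hy z hz hxy hxz hyz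
    by_contra! h
    exact hyz (hm x hx y hy z hz ⟨hxy, h.1⟩ ⟨hxz, h.2⟩)
  obtain ⟨a, T', ha, rfl, hT'⟩ := Finset.card_eq_succ.1 hT
  obtain ⟨b, c, d, hbc, hbd, hcd, rfl⟩ := Finset.card_eq_three.1 hT'
  obtain ⟨hab, hac, had⟩ : a ≠ b ∧ a ≠ c ∧ a ≠ d := by simpa using ha
  have ma : a ∈ ({a, b, c, d} : Finset (Fin 18)) := by simp
  have mb : b ∈ ({a, b, c, d} : Finset (Fin 18)) := by simp
  have mc : c ∈ ({a, b, c, d} : Finset (Fin 18)) := by simp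
  have md : d ∈ ({a, b, c, d} : Finset (Fin 18)) := by simp
  -- A graph on four vertices whose complement is a matching contains a cycle of length four.
  have a1 := hadj a ma b mb c mc hab hac hbc
  have a2 := hadj a ma b mb d md hab had hbd
  have a3 := hadj a ma c mc d md hac had hcd
  have b1 := hadj b mb a ma c mc hab.symm hbc hac
  have b2 := hadj b mb a ma d md hab.symm hbd had
  have b3 := hadj b mb c mc d md hbc hbd hcd
  have c1 := hadj c mc a ma b mb hac.symm hbc.symm hab
  have c2 := hadj c mc a ma d md hac.symm hcd had
  have c3 := hadj c mc b mb d md hbc.symm hcd hbd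
  have d1 := hadj d md a ma b mb had.symm hbd.symm hab
  have d2 := hadj d md a ma c mc had.symm hcd.symm hac
  have d3 := hadj d md b mb c mc hbd.symm hcd.symm hbc
  have n1 := fun h1 h2 h3 h4 => hbd (noFourCycle_G₄ a b h1 c h2 hac d h3 h4)
  have n2 := fun h1 h2 h3 h4 => hbc (noFourCycle_G₄ a b h1 d h2 had c h3 h4)
  have n3 := fun h1 h2 h3 h4 => hcd (noFourCycle_G₄ a c h1 b h2 hab d h3 h4)
  simp only [G₄.adj_comm d a, G₄.adj_comm c a, G₄.adj_comm b a, G₄.adj_comm c b,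
    G₄.adj_comm d b, G₄.adj_comm d c] at *
  grind

/-- Along an injective map `e`, the graph `G₄` has no defective sets. -/
theorem not_hasDefectiveSet_comap_G₄ {V : Type*} {e : V → Fin 18} (he : Function.Injective e) :
    ¬ (G₄.comap e).HasDefectiveSet 1 4 9 := by
  rintro (⟨S, hS, h⟩ | ⟨S, hS, h⟩)
  · refine noDense_G₄ (S.map ⟨e, he⟩) (by rw [Finset.card_map, hS]) ?_
    rw [IsDenseSet, isSparseSet_one_iff] at h
    intro v hv a ha b hb hva hvb
    obtain ⟨v, hv', rfl⟩ := Finset.mem_map.1 hv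
    obtain ⟨a, ha', rfl⟩ := Finset.mem_map.1 ha
    obtain ⟨b, hb', rfl⟩ := Finset.mem_map.1 hb
    rw [compl_adj] at hva hvb
    rw [h v hv' a ha' b hb' ⟨fun h => hva.1 (h ▸ rfl), hva.2⟩ ⟨fun h => hvb.1 (h ▸ rfl), hvb.2⟩]
  · refine noSparse_G₄ (S.map ⟨e, he⟩) (by rw [Finset.card_map, hS]) ?_
    rw [isSparseSet_one_iff] at h
    intro v hv a ha b hb hva hvb
    obtain ⟨v, hv', rfl⟩ := Finset.mem_map.1 hv
    obtain ⟨a, ha', rfl⟩ := Finset.mem_map.1 ha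
    obtain ⟨b, hb', rfl⟩ := Finset.mem_map.1 hb
    rw [h v hv' a ha' b hb' hva hvb]

theorem not_hasDefectiveSet_G₄ : ¬ G₄.HasDefectiveSet 1 4 9 :=
  not_hasDefectiveSet_comap_G₄ Function.injective_id

/-! ### The defective Ramsey number -/

theorem noSparse_of_not_hasDefectiveSet {V : Type*} {G : SimpleGraph V}
    (h : ¬ G.HasDefectiveSet 1 4 9) (W : Finset V) : NoSparse G W 9 :=
  fun T _ hT hm => h (Or.inr ⟨T, hT, isSparseSet_one_iff.2 hm⟩)

theorem IsPerfect.noShortCycle_of_not_hasDefectiveSet {V : Type*} {G : SimpleGraph V}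
    (hG : G.IsPerfect) (h : ¬ G.HasDefectiveSet 1 4 9) : NoShortCycle G :=
  hG.noShortCycle fun T hT hm => h (Or.inl ⟨T, hT, isSparseSet_one_iff.2 hm⟩)

theorem isDefectiveRamseyNumber_nineteen : IsDefectiveRamseyNumber perfectGraphs 1 4 9 19 := by
  refine ⟨fun G hG => ?_, fun n hn => ?_⟩
  · by_contra h
    have := (covers_nine_nineteen (IsPerfect.noShortCycle_of_not_hasDefectiveSet hG h)).card_lt
      (noSparse_of_not_hasDefectiveSet h Finset.univ)
    simp at this
  · by_contra! hlt
    exact not_hasDefectiveSet_comap_G₄ (Fin.castLE_injective (Nat.le_of_lt_succ hlt))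
      (hn _ (isPerfect_comap_G₄ _))

theorem nonempty_iso_G₄ {G : SimpleGraph (Fin 18)} (hG : G.IsPerfect)
    (h : ¬ G.HasDefectiveSet 1 4 9) : Nonempty (G ≃g G₄) := by
  obtain ⟨f, -, A, hA, hf⟩ := covers_nine_eighteen (hG.noShortCycle_of_not_hasDefectiveSet h)
    Finset.univ (Finset.card_fin 18) (noSparse_of_not_hasDefectiveSet h _)
  obtain rfl := List.mem_singleton.1 hA
  have hinj : Function.Injective fun i : Fin 18 => f i := fun i j hij =>
    Fin.ext (hf.inj i i.2 j j.2 hij)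
  refine ⟨(RelIso.mk (Equiv.ofBijective _ (Finite.injective_iff_bijective.1 hinj))
    fun {a b} => ?_ : G₄ ≃g G).symm⟩
  have h1 := hf.adj a b (by omega)
  rw [testBit_codeG₄, decide_eq_true_eq] at h1
  exact ⟨fun hab => h1.2 ⟨a.2, b.2, hab⟩, fun hab => (h1.1 hab).2.2⟩

end SimpleGraph

theorem theorem3p2 :
    SimpleGraph.IsDefectiveRamseyNumber SimpleGraph.perfectGraphs 1 4 9 19 ∧
      SimpleGraph.IsExtremalGraph SimpleGraph.perfectGraphs 1 4 9 SimpleGraph.G₄ ∧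
      ∀ (n : ℕ) (G : SimpleGraph (Fin n)),
        SimpleGraph.IsExtremalGraph SimpleGraph.perfectGraphs 1 4 9 G →
          Nonempty (G ≃g SimpleGraph.G₄) := by
  refine ⟨SimpleGraph.isDefectiveRamseyNumber_nineteen,
    ⟨SimpleGraph.isDefectiveRamseyNumber_nineteen, SimpleGraph.isPerfect_G₄,
      SimpleGraph.not_hasDefectiveSet_G₄⟩, ?_⟩
  rintro n G ⟨hr, hG, h⟩
  obtain rfl : n = 18 := by
    have := hr.unique SimpleGraph.isDefectiveRamseyNumber_nineteen
    omega
  exact SimpleGraph.nonempty_iso_G₄ hG h
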